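/- Throughout, $\infty$-categories are small. A *symmetric monoidal stable $\infty$-category* is an object of $\mathrm{CAlg}(\mathrm{Cat}_\infty^{\mathrm{st}})$: an idempotent-complete stable $\infty$-category with a symmetric monoidal structure whose tensor product is exact in each variable; morphisms are exact symmetric monoidal functors. A *tt-category* is a symmetric monoidal stable $\infty$-category $\mathcal T$ that is rigid (every object is dualizable). An object $x$ (resp. a morphism $f$) is *$\otimes$-nilpotent* if $x^{\otimes n}\simeq 0$ (resp. $f^{\otimes n}\simeq 0$) for some $n\ge 1$. A symmetric monoidal stable $\infty$-category is *local* if it is nonzero and whenever $x\otimes y\simeq 0$, either $x$ or $y$ is $\otimes$-nilpotent; a *local tt-category* is a tt-category that is local. An exact symmetric monoidal functor $F$ between local tt-categories is *local* if $F(c)\simeq 0$ if and only if $c\simeq 0$. A local tt-category $\mathcal T$ satisfies the *exact-nilpotence condition* if for every fiber sequence $$y\xrightarrow{\;g\;}\mathbb 1\xrightarrow{\;f\;}x$$ in $\mathcal T$ there is a nonzero object $z\in\mathcal T$ such that $z\otimes g$ or $z\otimes f$ is $\otimes$-nilpotent. **Theorem 3.14.** Let $J$ be a small filtered category and let $(\mathcal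 C_j)_{j\in J}$ be a $J$-indexed diagram of local tt-categories (in $\mathrm{CAlg}(\mathrm{Cat}_\infty^{\mathrm{st}})$) all of whose transition functors $\mathcal C_i\to\mathcal C_j$ are local. Suppose that every $\mathcal C_j$ satisfies the exact-nilpotence condition. Then the colimit $\mathcal C=\varinjlim_{j\in J}\mathcal C_j$ in $\mathrm{CAlg}(\mathrm{Cat}_\infty^{\mathrm{st}})$ is a local tt-category, and $\mathcal C$ satisfies the exact-nilpotence condition. -/

import Mathlib

open CategoryTheory Simplicial Opposite

universe u

/-! ## Morphisms, equivalences and zero objects in an `∞`-category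

An `∞`-category is a quasicategory `C : SSet`. Objects are vertices, morphisms are edges; an edge
`e` goes from `C.δ 1 e` to `C.δ 0 e`. A `2`-simplex `σ` exhibits `C.δ 1 σ` as a composite of
`C.δ 2 σ` followed by `C.δ 0 σ`. -/

namespace InfCat

variable {C D : SSet.{u}}

/-- The edge `e` goes from `a` to `b`. -/
def IsHom (e : C _⦋1⦌) (a b : C _⦋0⦌) : Prop := C.δ 1 e = a ∧ C.δ 0 e = b

/-- In the homotopy category, `h` is the composite of `f` followed by `g`. -/
def Comp (f g h : C _⦋1⦌) : Prop := ∃ σ : C _⦋2⦌, C.δ 2 σ = f ∧ C.δ 0 σ = g ∧ C.δ 1 σ = h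

/-- The edges `f` and `g` are homotopic, i.e. equal as morphisms of the homotopy category. -/
def Homotopic (f g : C _⦋1⦌) : Prop := Comp f (C.σ 0 (C.δ 0 f)) g

/-- The edge `f` is an equivalence, i.e. invertible in the homotopy category. -/
def IsEquivEdge (f : C _⦋1⦌) : Prop :=
  ∃ g : C _⦋1⦌, Comp f g (C.σ 0 (C.δ 1 f)) ∧ Comp g f (C.σ 0 (C.δ 0 f))

/-- The objects `a` and `b` are equivalent. -/
def Equivalent (a b : C _⦋0⦌) : Prop := ∃ e : C _⦋1⦌, IsHom e a b ∧ IsEquivEdge e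

/-- The edges `f` and `g` are isomorphic as arrows of the homotopy category: there are equivalences
`a`, `b` between their sources and targets such that `b ∘ f ≃ g ∘ a`. -/
def ArrowIso (f g : C _⦋1⦌) : Prop :=
  ∃ a b h : C _⦋1⦌, IsEquivEdge a ∧ IsEquivEdge b ∧ Comp f b h ∧ Comp a g h

/-- The vertex `k` of the boundary of a simplex of positive dimension. -/
def boundaryVertex (n : ℕ) (k : Fin (n + 2)) : (∂Δ[n + 1] : SSet.{u}) _⦋0⦌ :=
  ⟨SSet.stdSimplex.obj₀Equiv.symm k, by
    rw [SSet.mem_boundary_iff_notMem_range]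
    refine ⟨if k = 0 then 1 else 0, ?_⟩
    rintro ⟨i, hi⟩
    have h : k = (if k = 0 then 1 else 0) := hi
    split_ifs at h with hk
    · subst hk; simp at h
    · exact hk h⟩

/-- `x` is final: every `∂Δ[n] → C`, `n ≥ 1`, with last vertex `x` extends to `Δ[n]`. -/
def IsFinal (x : C _⦋0⦌) : Prop :=
  ∀ (n : ℕ) (φ : (∂Δ[n + 1] : SSet.{u}) ⟶ C),
    φ.app _ (boundaryVertex n (Fin.last _)) = x → ∃ ψ : Δ[n + 1] ⟶ C, ∂Δ[n + 1].ι ≫ ψ = φ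

/-- `x` is initial: every `∂Δ[n] → C`, `n ≥ 1`, with first vertex `x` extends to `Δ[n]`. -/
def IsInitial (x : C _⦋0⦌) : Prop :=
  ∀ (n : ℕ) (φ : (∂Δ[n + 1] : SSet.{u}) ⟶ C),
    φ.app _ (boundaryVertex n 0) = x → ∃ ψ : Δ[n + 1] ⟶ C, ∂Δ[n + 1].ι ≫ ψ = φ

/-- `x` is a zero object (written `x ≃ 0`). -/
def IsZeroObj (x : C _⦋0⦌) : Prop := IsInitial x ∧ IsFinal x

/-- `f ≃ 0`: the edge `f` factors through a zero object. -/
def IsNullEdge (f : C _⦋1⦌) : Prop :=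
  ∃ a b : C _⦋1⦌, IsZeroObj (C.δ 0 a) ∧ Comp a b f

/-! ## Squares, pullbacks and pushouts -/

/-- A square `Δ[1] × Δ[1] → C`, given by its two nondegenerate `2`-simplices. With the corners
numbered `0 = (0,0)`, `1 = (1,0)`, `2 = (0,1)`, `3 = (1,1)`, `upper` is the triangle `0 → 1 → 3`,
`lower` is the triangle `0 → 2 → 3`, and they share the diagonal `0 → 3`. -/
structure Square (C : SSet.{u}) where
  upper : C _⦋2⦌
  lower : C _⦋2⦌
  diag : C.δ 1 upper = C.δ 1 lower

/-- The image of a square under a functor. -/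
def Square.map (F : C ⟶ D) (s : Square C) : Square D where
  upper := F.app _ s.upper
  lower := F.app _ s.lower
  diag := by
    rw [← SSet.δ_naturality_apply, ← SSet.δ_naturality_apply, s.diag]

/-- The corner `2` of a square. -/
def Square.corner (s : Square C) : C _⦋0⦌ := C.δ 1 (C.δ 0 s.lower)

/-- The join `Δ^{m+1} ⋆ Λ^2_2`, where `Λ^2_2` is the shape `• → • ← •` of a cospan, as a
subcomplex of `Δ[m+4] = Δ^{m+1} ⋆ Δ^2`: the simplices that do not contain both of the vertices
`m+2` and `m+3`. -/
def joinCospan (m : ℕ) : (Δ[m + 4] : SSet.{u}).Subcomplex :=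
  SSet.stdSimplex.face {⟨m + 2, by omega⟩}ᶜ ⊔ SSet.stdSimplex.face {⟨m + 3, by omega⟩}ᶜ

/-- The join `∂Δ^{m+1} ⋆ Λ^2_2`: those simplices of `Δ^{m+1} ⋆ Λ^2_2` that miss one of the
vertices `0, …, m+1`. -/
def boundaryJoinCospan (m : ℕ) : (Δ[m + 4] : SSet.{u}).Subcomplex :=
  joinCospan m ⊓ ⨆ i : Fin (m + 2), SSet.stdSimplex.face {⟨i, by omega⟩}ᶜ

/-- The join `Λ^2_0 ⋆ Δ^{m+1}`, where `Λ^2_0` is the shape `• ← • → •` of a span, as a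
subcomplex of `Δ[m+4] = Δ^2 ⋆ Δ^{m+1}`: the simplices that do not contain both of the vertices
`1` and `2`. -/
def joinSpan (m : ℕ) : (Δ[m + 4] : SSet.{u}).Subcomplex :=
  SSet.stdSimplex.face {⟨1, by omega⟩}ᶜ ⊔ SSet.stdSimplex.face {⟨2, by omega⟩}ᶜ

/-- The join `Λ^2_0 ⋆ ∂Δ^{m+1}`: those simplices of `Λ^2_0 ⋆ Δ^{m+1}` that miss one of the
vertices `3, …, m+4`. -/
def boundaryJoinSpan (m : ℕ) : (Δ[m + 4] : SSet.{u}).Subcomplex :=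
  joinSpan m ⊓ ⨆ i : Fin (m + 2), SSet.stdSimplex.face {⟨i + 3, by omega⟩}ᶜ

/-- The triangle `m+1 → m+2 → m+4` of `∂Δ^{m+1} ⋆ Λ^2_2`. -/
def cospanUpper (m : ℕ) : (boundaryJoinCospan m : SSet.{u}) _⦋2⦌ :=
  ⟨SSet.stdSimplex.triangle ⟨m + 1, by omega⟩ ⟨m + 2, by omega⟩ ⟨m + 4, by omega⟩
      (by simp) (by simp), by
    refine ⟨Or.inr ?_, ?_⟩
    · rw [SSet.stdSimplex.mem_face_iff]
      intro i; fin_cases i <;> simp [SSet.stdSimplex.triangle]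
    · rw [Subfunctor.iSup_obj, Set.mem_iUnion]
      refine ⟨0, ?_⟩
      rw [SSet.stdSimplex.mem_face_iff]
      intro i; fin_cases i <;> simp [SSet.stdSimplex.triangle]⟩

/-- The triangle `m+1 → m+3 → m+4` of `∂Δ^{m+1} ⋆ Λ^2_2`. -/
def cospanLower (m : ℕ) : (boundaryJoinCospan m : SSet.{u}) _⦋2⦌ :=
  ⟨SSet.stdSimplex.triangle ⟨m + 1, by omega⟩ ⟨m + 3, by omega⟩ ⟨m + 4, by omega⟩
      (by simp) (by simp), by
    refine ⟨Or.inl ?_, ?_⟩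
    · rw [SSet.stdSimplex.mem_face_iff]
      intro i; fin_cases i <;> simp [SSet.stdSimplex.triangle]
    · rw [Subfunctor.iSup_obj, Set.mem_iUnion]
      refine ⟨0, ?_⟩
      rw [SSet.stdSimplex.mem_face_iff]
      intro i; fin_cases i <;> simp [SSet.stdSimplex.triangle]⟩

/-- The triangle `0 → 1 → 3` of `Λ^2_0 ⋆ ∂Δ^{m+1}`. -/
def spanUpper (m : ℕ) : (boundaryJoinSpan m : SSet.{u}) _⦋2⦌ :=
  ⟨SSet.stdSimplex.triangle ⟨0, by omega⟩ ⟨1, by omega⟩ ⟨3, by omega⟩ (by simp)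
      (by simp [Fin.le_def]), by
    refine ⟨Or.inr ?_, ?_⟩
    · rw [SSet.stdSimplex.mem_face_iff]
      intro i; fin_cases i <;> simp [SSet.stdSimplex.triangle]
    · rw [Subfunctor.iSup_obj, Set.mem_iUnion]
      refine ⟨Fin.last _, ?_⟩
      rw [SSet.stdSimplex.mem_face_iff]
      intro i; fin_cases i <;> simp [SSet.stdSimplex.triangle]⟩

/-- The triangle `0 → 2 → 3` of `Λ^2_0 ⋆ ∂Δ^{m+1}`. -/
def spanLower (m : ℕ) : (boundaryJoinSpan m : SSet.{u}) _⦋2⦌ :=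
  ⟨SSet.stdSimplex.triangle ⟨0, by omega⟩ ⟨2, by omega⟩ ⟨3, by omega⟩ (by simp)
      (by simp [Fin.le_def]), by
    refine ⟨Or.inl ?_, ?_⟩
    · rw [SSet.stdSimplex.mem_face_iff]
      intro i; fin_cases i <;> simp [SSet.stdSimplex.triangle]
    · rw [Subfunctor.iSup_obj, Set.mem_iUnion]
      refine ⟨Fin.last _, ?_⟩
      rw [SSet.stdSimplex.mem_face_iff]
      intro i; fin_cases i <;> simp [SSet.stdSimplex.triangle]⟩

/-- The square `s` is a pullback square, i.e. a final object of the slice `∞`-category of cones on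
its cospan `1 → 3 ← 2`: every map `∂Δ^n ⋆ Λ^2_2 → C`, `n ≥ 1`, whose restriction to
`{n} ⋆ Λ^2_2` is `s`, extends to `Δ^n ⋆ Λ^2_2`. -/
def IsPullback (s : Square C) : Prop :=
  ∀ (m : ℕ) (φ : (boundaryJoinCospan m : SSet.{u}) ⟶ C),
    φ.app _ (cospanUpper m) = s.upper → φ.app _ (cospanLower m) = s.lower →
    ∃ ψ : (joinCospan m : SSet.{u}) ⟶ C, SSet.Subcomplex.homOfLE inf_le_left ≫ ψ = φ

/-- The square `s` is a pushout square, i.e. an initial object of the slice `∞`-category of cones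
under its span `1 ← 0 → 2`: every map `Λ^2_0 ⋆ ∂Δ^n → C`, `n ≥ 1`, whose restriction to
`Λ^2_0 ⋆ {0}` is `s`, extends to `Λ^2_0 ⋆ Δ^n`. -/
def IsPushout (s : Square C) : Prop :=
  ∀ (m : ℕ) (φ : (boundaryJoinSpan m : SSet.{u}) ⟶ C),
    φ.app _ (spanUpper m) = s.upper → φ.app _ (spanLower m) = s.lower →
    ∃ ψ : (joinSpan m : SSet.{u}) ⟶ C, SSet.Subcomplex.homOfLE inf_le_left ≫ ψ = φ

/-- A triangle `X → Y → Z` is a square whose corner `2` is a zero object (here `X`, `Y`, `Z` are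
the corners `0`, `1`, `3`). It is a fiber sequence if it is a pullback square. -/
def IsFiberSeq (s : Square C) : Prop := IsZeroObj s.corner ∧ IsPullback s

/-- A triangle is a cofiber sequence if it is a pushout square. -/
def IsCofiberSeq (s : Square C) : Prop := IsZeroObj s.corner ∧ IsPushout s

/-- The first map `X → Y` of a triangle `X → Y → Z`. -/
def Square.first (s : Square C) : C _⦋1⦌ := C.δ 2 s.upper

/-- The second map `Y → Z` of a triangle `X → Y → Z`. -/
def Square.second (s : Square C) : C _⦋1⦌ := C.δ 0 s.upper

/-! ## Stable and idempotent complete `∞`-categories, exact functors -/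

/-- A stable `∞`-category: it has a zero object, every morphism has a fiber and a cofiber, and a
triangle is a fiber sequence if and only if it is a cofiber sequence. -/
structure IsStable (C : SSet.{u}) : Prop where
  quasicategory : SSet.Quasicategory C
  exists_zero : ∃ x : C _⦋0⦌, IsZeroObj x
  exists_fiber : ∀ f : C _⦋1⦌, ∃ s : Square C, IsFiberSeq s ∧ s.second = f
  exists_cofiber : ∀ f : C _⦋1⦌, ∃ s : Square C, IsCofiberSeq s ∧ s.first = f
  fiber_iff_cofiber : ∀ s : Square C, IsFiberSeq s ↔ IsCofiberSeq s

/-- An exact functor between stable `∞`-categories: it preserves zero objects and fiber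
sequences. -/
structure IsExact (F : C ⟶ D) : Prop where
  zero : ∀ x : C _⦋0⦌, IsZeroObj x → IsZeroObj (F.app _ x)
  fiber : ∀ s : Square C, IsFiberSeq s → IsFiberSeq (s.map F)

/-- The walking retract `Y → X → Y`, as the idempotent completion of the one-object category with
morphisms `{1, e}`, `e ∘ e = e` (the multiplicative monoid `ZMod 2`, with `e = 0`). -/
abbrev WalkingRetract : Type u := Idempotents.Karoubi (SingleObj (ULift.{u} (ZMod 2)))

/-- The walking idempotent: the full subcategory of the walking retract on the object `X`. -/
abbrev WalkingIdempotent : Type u :=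
  ObjectProperty.FullSubcategory
    (fun Z : WalkingRetract.{u} => Z = (Idempotents.toKaroubi _).obj (SingleObj.star _))

/-- `C` is idempotent complete: every (homotopy coherent) idempotent in `C` splits. -/
def IsIdemComplete (C : SSet.{u}) : Prop :=
  ∀ φ : nerve WalkingIdempotent.{u} ⟶ C, ∃ ψ : nerve WalkingRetract.{u} ⟶ C,
    nerveMap (ObjectProperty.ι _) ≫ ψ = φ

/-! ## Equivalences of `∞`-categories -/

/-- Two functors `F`, `G : C ⟶ D` are naturally equivalent: there is a homotopy between them
parametrized by the nerve of the walking isomorphism. -/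
def NatEquivalent (F G : C ⟶ D) : Prop :=
  ∃ H : MonoidalCategory.tensorObj C SSet.coherentIso.{u} ⟶ D,
    CartesianMonoidalCategory.lift (𝟙 C) (SSet.const SSet.coherentIso.x₀) ≫ H = F ∧
    CartesianMonoidalCategory.lift (𝟙 C) (SSet.const SSet.coherentIso.x₁) ≫ H = G

/-- `F` is an equivalence of `∞`-categories. -/
def IsEquivalence (F : C ⟶ D) : Prop :=
  ∃ G : D ⟶ C, NatEquivalent (F ≫ G) (𝟙 C) ∧ NatEquivalent (G ≫ F) (𝟙 D)

end InfCat

/-! ## Symmetric monoidal `∞`-categories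

A symmetric monoidal `∞`-category is a commutative monoid object in `Cat_∞`: a functor from the
category `Fin_*` of finite pointed sets to `∞`-categories satisfying the Segal condition. Functors
from an ordinary category to `Cat_∞` are represented by strict functors with values in
quasicategories, and their natural transformations by strict ones. -/

/-- The category `Fin_*` of finite pointed sets `⟨n⟩ = {*, 1, …, n}`. -/
structure FinPt where
  n : ℕ

namespace FinPt

/-- A pointed map `⟨n⟩ → ⟨m⟩` is a function `Fin n → Option (Fin m)`, `none` being the base
point. -/
instance : Category.{0} FinPt where
  Hom a b := Fin a.n → Option (Fin b.n)
  id _ := fun i => some i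
  comp f g := fun i => (f i).bind g
  id_comp _ := rfl
  comp_id f := by funext i; exact Option.bind_fun_some (f i)
  assoc f g h := by funext i; exact Option.bind_assoc (f i) g h

/-- The pointed map `⟨n⟩ → ⟨m⟩` with the given values. -/
def ofFun {n m : ℕ} (f : Fin n → Option (Fin m)) : FinPt.mk n ⟶ FinPt.mk m := f

/-- The map `ρ^i : ⟨n⟩ → ⟨1⟩` sending `i` to `1` and the rest to the base point. -/
def proj {n : ℕ} (i : Fin n) : FinPt.mk n ⟶ FinPt.mk 1 :=
  ofFun fun k => if k = i then some 0 else none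

/-- The map `⟨n⟩ → ⟨1⟩` sending every non-base point to `1`. -/
def fold (n : ℕ) : FinPt.mk n ⟶ FinPt.mk 1 := ofFun fun _ => some 0

end FinPt

/-- `Fin_*`-shaped diagrams of simplicial sets. -/
abbrev GammaSSet := FinPt ⥤ SSet.{u}

namespace GammaSSet

open InfCat

variable (X : GammaSSet.{u})

/-- The value `X⟨n⟩`, which is equivalent to the `n`-th power of `X⟨1⟩`. -/
abbrev level (n : ℕ) : SSet.{u} := X.obj (FinPt.mk n)

/-- The underlying `∞`-category `X⟨1⟩`. -/
abbrev underlying : SSet.{u} := X.level 1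

variable {X}

/-- The action of a pointed map on the `d`-simplices of the `X⟨n⟩`. -/
def act {n m : ℕ} (f : Fin n → Option (Fin m)) {d : ℕ} (σ : X.level n _⦋d⦌) : X.level m _⦋d⦌ :=
  (X.map (FinPt.ofFun f)).app (op ⦋d⦌) σ

/-- The `i`-th component of a simplex of `X⟨n⟩ ≃ X⟨1⟩ⁿ`. -/
def comp {n : ℕ} (i : Fin n) {d : ℕ} (σ : X.level n _⦋d⦌) : X.underlying _⦋d⦌ :=
  (X.map (FinPt.proj i)).app (op ⦋d⦌) σ

/-- The tensor product of the components of a simplex of `X⟨n⟩ ≃ X⟨1⟩ⁿ`. -/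
def mul {n : ℕ} {d : ℕ} (σ : X.level n _⦋d⦌) : X.underlying _⦋d⦌ :=
  (X.map (FinPt.fold n)).app (op ⦋d⦌) σ

/-- The unit object `𝟙`. As `X⟨0⟩` is contractible, all choices of `v` give equivalent objects. -/
def unit (v : X.level 0 _⦋0⦌) : X.underlying _⦋0⦌ := mul v

variable (X)

/-- `X` is a symmetric monoidal `∞`-category: all `X⟨n⟩` are `∞`-categories and the Segal maps
`X⟨n⟩ → X⟨1⟩ⁿ` are equivalences. -/
structure IsSymMon : Prop where
  quasicategory : ∀ n, SSet.Quasicategory (X.level n)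
  segal : ∀ n, IsEquivalence
    (Limits.Pi.lift fun i : Fin n => X.map (FinPt.proj i) :
      X.level n ⟶ ∏ᶜ fun _ : Fin n => X.underlying)

/-- The tensor product is exact in each variable. A square in `X⟨2⟩` whose `i`-th component is a
fiber sequence `σ` and all edges of whose other component are equivalences is, up to equivalence,
the pair of `σ` and a constant square at an object `c`; its image under the multiplication is then
`σ ⊗ c` (or `c ⊗ σ`). -/
structure IsBiexact : Prop where
  zero : ∀ (i : Fin 2) (p : X.level 2 _⦋0⦌), IsZeroObj (comp i p) → IsZeroObj (mul p)
  fiber : ∀ (i j : Fin 2) (s : Square (X.level 2)), i ≠ j →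
    IsFiberSeq (s.map (X.map (FinPt.proj i))) →
    (∀ k : Fin 3, IsEquivEdge ((X.level 1).δ k (comp j s.upper)) ∧
      IsEquivEdge ((X.level 1).δ k (comp j s.lower))) →
    IsFiberSeq (s.map (X.map (FinPt.fold 2)))

/-- A symmetric monoidal stable `∞`-category, i.e. an object of `CAlg(Cat_∞^st)`: stable,
idempotent complete, with tensor product exact in each variable. -/
structure IsSymMonStable : Prop where
  symMon : X.IsSymMon
  stable : IsStable X.underlying
  idemComplete : IsIdemComplete X.underlying
  biexact : X.IsBiexact

variable {X}

/-- `y` is a dual of `x`: there are `c : 𝟙 → y ⊗ x` and `e : x ⊗ y → 𝟙` such that both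
composites `x → x ⊗ (y ⊗ x) ≃ (x ⊗ y) ⊗ x → x` and `y → (y ⊗ x) ⊗ y ≃ y ⊗ (x ⊗ y) → y` are
homotopic to the identity.

Here `q` is the quadruple `(x₁, y₁, x₂, y₂)` of two copies of `x` and two of `y`, and
`θ : (x₁, y₁) → (x₂, y₂)` identifies the two copies of `(x, y)`. The coevaluation is
`c : 𝟙 → y₁ ⊗ x₂`, the evaluation is `e : x₁ ⊗ y₁ → 𝟙`, which corresponds to
`e' : x₂ ⊗ y₂ → 𝟙` under `θ`. The edges `f₁ : (x₁, 𝟙) → (x₁, y₁ ⊗ x₂)` and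
`f₂ : (x₁ ⊗ y₁, x₂) → (𝟙, x₂)` are `(id, c)` and `(e, id)`, and the composite of `x₁ ⊗ c` and
`e ⊗ x₂` is the identification `x₁ → x₂`. The edges `g₁ : (𝟙, y₂) → (y₁ ⊗ x₂, y₂)` and
`g₂ : (y₁, x₂ ⊗ y₂) → (y₁, 𝟙)` are `(c, id)` and `(id, e')`, and the composite
`k : y₂ → y₁` of `c ⊗ y₂` and `y₁ ⊗ e'` is inverse to the identification `y₁ → y₂`. -/
def IsDual (x y : X.underlying _⦋0⦌) : Prop :=
  ∃ (q : X.level 4 _⦋0⦌) (θ : X.level 2 _⦋1⦌) (c e e' : X.underlying _⦋1⦌)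
    (f₁ f₂ g₁ g₂ : X.level 2 _⦋1⦌) (k : X.underlying _⦋1⦌),
    Equivalent (comp 0 q) x ∧ Equivalent (comp 1 q) y ∧
    IsHom θ (act ![some 0, some 1, none, none] q) (act ![none, none, some 0, some 1] q) ∧
    IsEquivEdge θ ∧
    IsHom c (unit (act ![none, none, none, none] q)) (act ![none, some 0, some 0, none] q) ∧
    IsHom e (act ![some 0, some 0, none, none] q) (unit (act ![none, none, none, none] q)) ∧
    IsHom e' (act ![none, none, some 0, some 0] q) (unit (act ![none, none, none, none] q)) ∧
    Comp (mul θ) e' e ∧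
    -- first triangle identity
    IsHom f₁ (act ![some 0, none, none, none] q) (act ![some 0, some 1, some 1, none] q) ∧
    Homotopic (comp 0 f₁) ((X.level 1).σ 0 (comp 0 q)) ∧ Homotopic (comp 1 f₁) c ∧
    IsHom f₂ (act ![some 0, some 0, some 1, none] q) (act ![none, none, some 1, none] q) ∧
    Homotopic (comp 0 f₂) e ∧ Homotopic (comp 1 f₂) ((X.level 1).σ 0 (comp 2 q)) ∧
    Comp (mul f₁) (mul f₂) (comp 0 θ) ∧
    -- second triangle identity
    IsHom g₁ (act ![none, none, none, some 1] q) (act ![none, some 0, some 0, some 1] q) ∧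
    Homotopic (comp 0 g₁) c ∧ Homotopic (comp 1 g₁) ((X.level 1).σ 0 (comp 3 q)) ∧
    IsHom g₂ (act ![none, some 0, some 1, some 1] q) (act ![none, some 0, none, none] q) ∧
    Homotopic (comp 0 g₂) ((X.level 1).σ 0 (comp 1 q)) ∧ Homotopic (comp 1 g₂) e' ∧
    Comp (mul g₁) (mul g₂) k ∧
    Comp (comp 1 θ) k ((X.level 1).σ 0 (comp 1 q))

variable (X)

/-- A tt-category: an idempotent complete symmetric monoidal stable `∞`-category which is rigid,
i.e. in which every object has a dual. -/
structure IsTTCat : Prop extends X.IsSymMonStable where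
  rigid : ∀ x : X.underlying _⦋0⦌, ∃ y, IsDual x y

variable {X}

/-- `x ⊗ y ≃ 0`. -/
def TensorIsZero (x y : X.underlying _⦋0⦌) : Prop :=
  ∃ p : X.level 2 _⦋0⦌,
    Equivalent (comp 0 p) x ∧ Equivalent (comp 1 p) y ∧ IsZeroObj (mul p)

/-- The object `x` is `⊗`-nilpotent: `x^{⊗n} ≃ 0` for some `n ≥ 1`. -/
def IsNilpotentObj (x : X.underlying _⦋0⦌) : Prop :=
  ∃ n : ℕ, 1 ≤ n ∧ ∃ p : X.level n _⦋0⦌, (∀ i, Equivalent (comp i p) x) ∧ IsZeroObj (mul p)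

/-- The morphism `f` is `⊗`-nilpotent: `f^{⊗n} ≃ 0` for some `n ≥ 1`. -/
def IsNilpotentEdge (f : X.underlying _⦋1⦌) : Prop :=
  ∃ n : ℕ, 1 ≤ n ∧ ∃ p : X.level n _⦋1⦌, (∀ i, ArrowIso (comp i p) f) ∧ IsNullEdge (mul p)

/-- The morphism `z ⊗ f` is `⊗`-nilpotent. -/
def TensorIsNilpotent (z : X.underlying _⦋0⦌) (f : X.underlying _⦋1⦌) : Prop :=
  ∃ p : X.level 2 _⦋1⦌, ArrowIso (comp 0 p) ((X.level 1).σ 0 z) ∧ ArrowIso (comp 1 p) f ∧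
    IsNilpotentEdge (mul p)

variable (X)

/-- `X` is local: it is nonzero, and if `x ⊗ y ≃ 0` then `x` or `y` is `⊗`-nilpotent. -/
structure IsLocal : Prop where
  nonzero : ∃ x : X.underlying _⦋0⦌, ¬ IsZeroObj x
  nilpotent : ∀ x y : X.underlying _⦋0⦌, TensorIsZero x y → IsNilpotentObj x ∨ IsNilpotentObj y

/-- A local tt-category. -/
structure IsLocalTTCat : Prop extends X.IsTTCat, X.IsLocal

/-- The exact-nilpotence condition: for every fiber sequence `y → 𝟙 → x`, with maps `g` and `f`,
there is a nonzero object `z` such that `z ⊗ g` or `z ⊗ f` is `⊗`-nilpotent. -/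
def ExactNilpotence : Prop :=
  ∀ (v : X.level 0 _⦋0⦌) (s : Square X.underlying), IsFiberSeq s →
    X.underlying.δ 0 s.first = unit v →
    ∃ z : X.underlying _⦋0⦌, ¬ IsZeroObj z ∧
      (TensorIsNilpotent z s.first ∨ TensorIsNilpotent z s.second)

variable {X}

/-- A symmetric monoidal functor (a map of `Fin_*`-shaped diagrams) is exact if the underlying
functor is; these are the morphisms of `CAlg(Cat_∞^st)`. -/
def IsExactFunctor {Y : GammaSSet.{u}} (F : X ⟶ Y) : Prop := IsExact (F.app (FinPt.mk 1))

/-- A symmetric monoidal functor is local if `F(c) ≃ 0` iff `c ≃ 0`. -/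
def IsLocalFunctor {Y : GammaSSet.{u}} (F : X ⟶ Y) : Prop :=
  ∀ c : X.underlying _⦋0⦌, IsZeroObj ((F.app (FinPt.mk 1)).app _ c) ↔ IsZeroObj c

/-- The cocone `c` exhibits its point as the `∞`-categorical colimit of the filtered diagram `D`.
Filtered colimits in `CAlg(Cat_∞^st)` are computed in `Fun(Fin_*, Cat_∞)`, levelwise, and
filtered colimits of quasicategories are, up to equivalence, colimits of simplicial sets; so the
condition is that `colim_j D_j⟨n⟩ → c⟨n⟩` is an equivalence of `∞`-categories for all `n`. -/
def IsFilteredColimit {J : Type u} [SmallCategory J] {D : J ⥤ GammaSSet.{u}}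
    (c : Limits.Cocone D) : Prop :=
  ∀ n : ℕ, IsEquivalence ((Limits.colimit.desc D c).app (FinPt.mk n))

end GammaSSet

/-! Everything descends to a finite stage. Up to equivalence, each object and each morphism of the
colimit comes from some stage, and an equivalence between two images already exists at a later
stage, because it consists of finitely many simplices and equations between them. Consequently an
object `x` of a stage whose image is zero becomes equivalent to a zero object at a later stage, and
locality of the transition functor gives `x ≃ 0` (`IsFilteredColimit.isZeroObj`). So the legs of the
cocone detect zero objects.

Rigidity follows since duality data are preserved by any symmetric monoidal functor. If `x ⊗ y ≃ 0`,
the pair descends to a stage, where its product is zero by detection; there one factor is nilpotent,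
and so is its image.

For exact-nilpotence, let `y → 𝟙 → x` be a fiber sequence with maps `g`, `f`. Only `g` is descended,
to a map `e` into the unit of a stage, and one takes the cofiber `q` of `e` there. The hypothesis at
that stage gives a nonzero `z` with `z ⊗ e` or `z ⊗ q` nilpotent, and the image of `z` is still
nonzero. In the first case the image of `z` works for `g`. In the second, `f` kills the image of `e`
up to isomorphism, so it factors through the image of `q` (`IsCofiberSeq.exists_comp`); nilpotence
survives postcomposition (`TensorIsNilpotent.of_comp`, by the Segal condition). Only the existence
half of the universal property of the cofiber is needed.

The groundwork makes the lifting-style definitions usable: equations between morphisms are checked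
in the homotopy category (`comp_iff`), and zero objects are invariant under equivalence
(`IsZeroObj.of_equivalent`), because a retract of an initial object is initial
(`isInitial_of_retract`). -/

namespace SSet

/-! ### Horns and boundaries described by families of faces -/

variable {X : SSet.{u}}

/-- The family `y` is indexed by all faces for convenience. Its entry at the horn index `i` is never
used, and callers put an arbitrary simplex there. -/
lemma exists_horn_filler [Quasicategory X] {n : ℕ} (i : Fin (n + 3)) (h0 : 0 < i)
    (hn : i < Fin.last (n + 2)) (y : Fin (n + 3) → X _⦋n + 1⦌)
    (hy : ∀ j k : Fin (n + 2), j ≤ k → j.castSucc ≠ i → k.succ ≠ i →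
      X.δ j (y k.succ) = X.δ k (y j.castSucc)) :
    ∃ a : X _⦋n + 2⦌, ∀ j, j ≠ i → X.δ j a = y j := by
  have hc : horn.IsCompatible (i := i) (fun j _ => yonedaEquiv.symm (y j)) := by
    rw [horn.isCompatible_iff]
    intro j k hj hk hjk
    obtain ⟨j, rfl⟩ := j.eq_castSucc_of_ne_last (Fin.ne_last_of_lt hjk)
    obtain ⟨k, rfl⟩ := k.eq_succ_of_ne_zero (Fin.ne_zero_of_lt hjk)
    rw [Fin.pred_succ, Fin.castPred_castSucc, stdSimplex.δ_comp_yonedaEquiv_symm,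
      stdSimplex.δ_comp_yonedaEquiv_symm, hy j k (by grind) hj hk]
  obtain ⟨φ, hφ⟩ := hc.exists_desc
  obtain ⟨σ, hσ⟩ := Quasicategory.hornFilling h0 hn φ
  refine ⟨yonedaEquiv σ, fun j hj => ?_⟩
  rw [← stdSimplex.yonedaEquiv_δ_comp, ← horn.ι_ι i j hj, Category.assoc, ← hσ, hφ j hj,
    Equiv.apply_symm_apply]

/-- Gluing is simplexwise: choose a piece containing each simplex. Naturality holds because the
pieces chosen for a simplex and for its image under an operator agree on that image. -/
lemma Subcomplex.exists_desc {Z : SSet.{u}} {ι : Type*} (A : Z.Subcomplex)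
    (B : ι → Z.Subcomplex) (hA : ∀ d, ∀ z ∈ A.obj d, ∃ i, z ∈ (B i).obj d)
    (g : ∀ i, (B i : SSet.{u}) ⟶ X)
    (hg : ∀ i j d z (hi : z ∈ (B i).obj d) (hj : z ∈ (B j).obj d),
      (g i).app d ⟨z, hi⟩ = (g j).app d ⟨z, hj⟩) :
    ∃ φ : (A : SSet.{u}) ⟶ X, ∀ i d z (h : z ∈ A.obj d) (hi : z ∈ (B i).obj d),
      φ.app d ⟨z, h⟩ = (g i).app d ⟨z, hi⟩ := by
  choose c hc using hA
  refine ⟨{ app := fun d => ↾fun z => (g (c d z.1 z.2)).app d ⟨z.1, hc d z.1 z.2⟩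
            naturality := fun d e f => ?_ }, fun i d z h hi => hg _ _ _ _ _ _⟩
  ext ⟨z, hz⟩
  refine (hg _ (c d z hz) _ _ _ ((B (c d z hz)).map f (hc d z hz))).trans ?_
  exact NatTrans.naturality_apply (g (c d z hz)) f ⟨z, hc d z hz⟩

lemma Subcomplex.app_eq_of_homOfLE_comp_eq {Z : SSet.{u}} {A B C : Z.Subcomplex} (hA : C ≤ A)
    (hB : C ≤ B) (g : (A : SSet.{u}) ⟶ X) (h : (B : SSet.{u}) ⟶ X)
    (e : homOfLE hA ≫ g = homOfLE hB ≫ h) (d : SimplexCategoryᵒᵖ) (z : Z.obj d)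
    (hz : z ∈ C.obj d) : g.app d ⟨z, hA _ hz⟩ = h.app d ⟨z, hB _ hz⟩ :=
  ConcreteCategory.congr_hom (congr_app e d) ⟨z, hz⟩

/-- A family of `n`-simplices satisfying the identities of the faces of an `(n+1)`-simplex. -/
def FaceCompatible {n : ℕ} : (Fin (n + 2) → X _⦋n⦌) → Prop :=
  Nat.casesOn (motive := fun n => (Fin (n + 2) → X _⦋n⦌) → Prop) n (fun _ => True)
    fun n y => ∀ j k : Fin (n + 2), j ≤ k → X.δ j (y k.succ) = X.δ k (y j.castSucc)

lemma faceCompatible_of_hom {n : ℕ} (φ : (∂Δ[n + 1] : SSet) ⟶ X) :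
    FaceCompatible (fun j => yonedaEquiv (boundary.ι j ≫ φ)) := by
  cases n with
  | zero => trivial
  | succ n =>
    intro j k hjk
    dsimp only
    rw [← stdSimplex.yonedaEquiv_δ_comp, ← stdSimplex.yonedaEquiv_δ_comp, ← Category.assoc,
      ← Category.assoc]
    congr 2
    rw [← cancel_mono (Subcomplex.ι _), Category.assoc, Category.assoc, boundary.ι_ι,
      boundary.ι_ι, stdSimplex.δ_comp_δ hjk]

lemma exists_boundary_desc {n : ℕ} (f : Fin (n + 2) → X _⦋n⦌) (hf : FaceCompatible f) :
    ∃ φ : (∂Δ[n + 1] : SSet) ⟶ X, ∀ j, boundary.ι j ≫ φ = yonedaEquiv.symm (f j) := by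
  have key : ∀ (i j : Fin (n + 2)), i < j → ∀ d z (hi : z ∈ (stdSimplex.face {i}ᶜ).obj d)
      (hj : z ∈ (stdSimplex.face {j}ᶜ).obj d),
      ((stdSimplex.faceSingletonComplIso i).inv ≫ yonedaEquiv.symm (f i)).app d ⟨z, hi⟩ =
      ((stdSimplex.faceSingletonComplIso j).inv ≫ yonedaEquiv.symm (f j)).app d ⟨z, hj⟩ := by
    intro i j hij d z hi hj
    cases n with
    | zero =>
      -- The two faces of `Δ[1]` are disjoint: a vertex of `z` would have to avoid both `0` and `1`.
      obtain ⟨rfl, rfl⟩ : i = 0 ∧ j = 1 := by grind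
      induction d using Opposite.rec with
      | op d =>
      induction d using SimplexCategory.rec with
      | mk d =>
      have h1 := (stdSimplex.mem_face_iff _ _).1 hi 0
      have h2 := (stdSimplex.mem_face_iff _ _).1 hj 0
      generalize z 0 = w at h1 h2
      fin_cases w <;> simp at h1 h2
    | succ n =>
      have hz : z ∈ (stdSimplex.face {i, j}ᶜ).obj d := by
        have : z ∈ (stdSimplex.face {i}ᶜ ⊓ stdSimplex.face {j}ᶜ).obj d := ⟨hi, hj⟩
        rw [stdSimplex.face_inter_face] at this
        have e : ({i, j}ᶜ : Finset (Fin (n + 3))) = {i}ᶜ ⊓ {j}ᶜ := by ext; simp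
        rwa [e]
      have e1 := stdSimplex.homOfLE_faceSingletonComplIso_inv_eq_facePairComplIso_inv_δ_pred_assoc
        i j hij (yonedaEquiv.symm (f i))
      have e2 :=
        stdSimplex.homOfLE_faceSingletonComplIso_inv_eq_facePairComplIso_inv_δ_castPred_assoc
        i j hij (yonedaEquiv.symm (f j))
      obtain ⟨i, rfl⟩ := i.eq_castSucc_of_ne_last (Fin.ne_last_of_lt hij)
      obtain ⟨j, rfl⟩ := j.eq_succ_of_ne_zero (Fin.ne_zero_of_lt hij)
      rw [Fin.pred_succ, stdSimplex.δ_comp_yonedaEquiv_symm, ← hf i j (by grind)] at e1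
      rw [Fin.castPred_castSucc, stdSimplex.δ_comp_yonedaEquiv_symm, ← e1] at e2
      exact (Subcomplex.app_eq_of_homOfLE_comp_eq _ _ _ _ e2 d z hz).symm
  obtain ⟨φ, hφ⟩ := Subcomplex.exists_desc (X := X) (∂Δ[n + 1])
    (fun i : Fin (n + 2) => stdSimplex.face {i}ᶜ)
    (fun d z hz => by
      rw [boundary_eq_iSup, Subfunctor.iSup_obj, Set.mem_iUnion] at hz; exact hz)
    (fun i => (stdSimplex.faceSingletonComplIso i).inv ≫ yonedaEquiv.symm (f i))
    (fun i j d z hi hj => by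
      rcases lt_trichotomy i j with h | rfl | h
      · exact key i j h d z hi hj
      · rfl
      · exact (key j i h d z hj hi).symm)
  refine ⟨φ, fun j => ?_⟩
  rw [← cancel_epi (stdSimplex.faceSingletonComplIso j).inv,
    boundary.faceSingletonComplIso_inv_ι_assoc]
  ext d ⟨z, hz⟩
  exact hφ j d z (face_singleton_compl_le_boundary j _ hz) hz

lemma exists_horn_filler_two [Quasicategory X] (f g : X _⦋1⦌) (h : X.δ 0 f = X.δ 1 g) :
    ∃ a : X _⦋2⦌, X.δ 2 a = f ∧ X.δ 0 a = g := by
  obtain ⟨a, ha⟩ := exists_horn_filler (X := X) (n := 0) 1 (by simp) (by decide)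
    ![g, g, f] (by
      intro j k hjk hj hk
      fin_cases j <;> fin_cases k <;> simp_all)
  exact ⟨a, ha 2 (by decide), ha 0 (by decide)⟩

/-- The three fields are the inner horns of dimensions 2 and 3. They are what the construction of
the homotopy category from the 2-truncation requires. -/
instance quasicategory₂_truncation [Quasicategory X] :
    Truncated.Quasicategory₂ ((truncation 2).obj X) where
  fill21 e₀₁ e₁₂ := by
    obtain ⟨a, h2, h0⟩ := exists_horn_filler_two (X := X) e₀₁.edge e₁₂.edge
      (e₀₁.tgt_eq.trans e₁₂.src_eq.symm)
    refine ⟨⟨⟨X.δ 1 a, ?_, ?_⟩, ⟨a, h2, h0, rfl⟩⟩⟩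
    · refine Eq.trans ?_ e₀₁.src_eq
      refine Eq.trans ?_ (congrArg (X.δ 1) h2)
      exact (X.δ_comp_δ_apply (i := 1) (j := 1) le_rfl a).symm
    · refine Eq.trans ?_ e₁₂.tgt_eq
      refine Eq.trans ?_ (congrArg (X.δ 0) h0)
      exact (X.δ_comp_δ_apply (i := 0) (j := 0) le_rfl a)
  fill31 f₃ f₀ f₂ := by
    obtain ⟨a, ha⟩ := exists_horn_filler (X := X) (n := 1) 1 (by decide) (by decide)
      ![f₀.simplex, f₀.simplex, f₂.simplex, f₃.simplex] (by
        intro j k hjk hj hk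
        have h02 : X.δ 0 f₂.simplex = X.δ 1 f₀.simplex := f₂.d₀.trans f₀.d₁.symm
        have h03 : X.δ 0 f₃.simplex = X.δ 2 f₀.simplex := f₃.d₀.trans f₀.d₂.symm
        have h23 : X.δ 2 f₃.simplex = X.δ 2 f₂.simplex := f₃.d₂.trans f₂.d₂.symm
        fin_cases j <;> fin_cases k <;> first | (exact h02) | (exact h03) | (exact h23) | simp_all)
    have e0 : X.δ 0 a = f₀.simplex := ha 0 (by decide)
    have e2 : X.δ 2 a = f₂.simplex := ha 2 (by decide)
    have e3 : X.δ 3 a = f₃.simplex := ha 3 (by decide)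
    refine ⟨⟨X.δ 1 a, ?_, ?_, ?_⟩⟩
    · refine Eq.trans (?_ : _ = X.δ 1 f₃.simplex) f₃.d₁
      rw [← e3]
      exact (X.δ_comp_δ_apply (i := 1) (j := 2) (by decide) a).symm
    · refine Eq.trans (?_ : _ = X.δ 0 f₀.simplex) f₀.d₀
      rw [← e0]
      exact (X.δ_comp_δ_apply (i := 0) (j := 0) (by decide) a)
    · refine Eq.trans (?_ : _ = X.δ 1 f₂.simplex) f₂.d₁
      rw [← e2]
      exact (X.δ_comp_δ_apply (i := 1) (j := 1) (by decide) a).symm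
  fill32 f₃ f₀ f₁ := by
    obtain ⟨a, ha⟩ := exists_horn_filler (X := X) (n := 1) 2 (by decide) (by decide)
      ![f₀.simplex, f₁.simplex, f₁.simplex, f₃.simplex] (by
        intro j k hjk hj hk
        have h01 : X.δ 0 f₁.simplex = X.δ 0 f₀.simplex := f₁.d₀.trans f₀.d₀.symm
        have h03 : X.δ 0 f₃.simplex = X.δ 2 f₀.simplex := f₃.d₀.trans f₀.d₂.symm
        have h13 : X.δ 1 f₃.simplex = X.δ 2 f₁.simplex := f₃.d₁.trans f₁.d₂.symm
        fin_cases j <;> fin_cases k <;> first | (exact h01) | (exact h03) | (exact h13) | simp_all)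
    have e0 : X.δ 0 a = f₀.simplex := ha 0 (by decide)
    have e1 : X.δ 1 a = f₁.simplex := ha 1 (by decide)
    have e3 : X.δ 3 a = f₃.simplex := ha 3 (by decide)
    refine ⟨⟨X.δ 2 a, ?_, ?_, ?_⟩⟩
    · refine Eq.trans (?_ : _ = X.δ 2 f₃.simplex) f₃.d₂
      rw [← e3]
      exact (X.δ_comp_δ_apply (i := 2) (j := 2) (by decide) a).symm
    · refine Eq.trans (?_ : _ = X.δ 1 f₀.simplex) f₀.d₁
      rw [← e0]
      exact (X.δ_comp_δ_apply (i := 0) (j := 1) (by decide) a)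
    · refine Eq.trans (?_ : _ = X.δ 1 f₁.simplex) f₁.d₁
      rw [← e1]
      exact (X.δ_comp_δ_apply (i := 1) (j := 1) (by decide) a)

end SSet

/-! ### The homotopy category of a quasicategory -/

namespace InfCat

open SSet

variable {C D : SSet.{u}}

lemma Comp.source_eq {f g h : C _⦋1⦌} (H : Comp f g h) : C.δ 1 f = C.δ 1 h := by
  obtain ⟨σ, rfl, rfl, rfl⟩ := H
  exact C.δ_comp_δ_apply (i := 1) (j := 1) le_rfl σ

lemma Comp.target_eq {f g h : C _⦋1⦌} (H : Comp f g h) : C.δ 0 g = C.δ 0 h := by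
  obtain ⟨σ, rfl, rfl, rfl⟩ := H
  exact (C.δ_comp_δ_apply (i := 0) (j := 0) le_rfl σ).symm

lemma Comp.middle_eq {f g h : C _⦋1⦌} (H : Comp f g h) : C.δ 0 f = C.δ 1 g := by
  obtain ⟨σ, rfl, rfl, rfl⟩ := H
  exact C.δ_comp_δ_apply (i := 0) (j := 1) zero_le_one σ

lemma Comp.map {f g h : C _⦋1⦌} (H : Comp f g h) (F : C ⟶ D) :
    Comp (F.app _ f) (F.app _ g) (F.app _ h) := by
  obtain ⟨σ, rfl, rfl, rfl⟩ := H
  exact ⟨F.app _ σ, (δ_naturality_apply F 2 σ).symm, (δ_naturality_apply F 0 σ).symm,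
    (δ_naturality_apply F 1 σ).symm⟩

lemma isHom_self (e : C _⦋1⦌) : IsHom e (C.δ 1 e) (C.δ 0 e) := ⟨rfl, rfl⟩

lemma IsHom.map {e : C _⦋1⦌} {a b : C _⦋0⦌} (h : IsHom e a b) (F : C ⟶ D) :
    IsHom (F.app _ e) (F.app _ a) (F.app _ b) := by
  obtain ⟨rfl, rfl⟩ := h
  exact ⟨(δ_naturality_apply F 1 e).symm, (δ_naturality_apply F 0 e).symm⟩

lemma isHom_degenerate (a : C _⦋0⦌) : IsHom (C.σ 0 a) a a :=
  ⟨C.δ_comp_σ_succ_apply 0 a, C.δ_comp_σ_self_apply 0 a⟩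

lemma IsEquivEdge.map {e : C _⦋1⦌} (h : IsEquivEdge e) (F : C ⟶ D) :
    IsEquivEdge (F.app _ e) := by
  obtain ⟨g, h₁, h₂⟩ := h
  refine ⟨F.app _ g, ?_, ?_⟩
  · simpa only [σ_naturality_apply, δ_naturality_apply] using h₁.map F
  · simpa only [σ_naturality_apply, δ_naturality_apply] using h₂.map F

lemma Homotopic.map {f g : C _⦋1⦌} (h : Homotopic f g) (F : C ⟶ D) :
    Homotopic (F.app _ f) (F.app _ g) := by
  have := Comp.map h F
  rwa [σ_naturality_apply, δ_naturality_apply] at this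

lemma Equivalent.map {a b : C _⦋0⦌} (h : Equivalent a b) (F : C ⟶ D) :
    Equivalent (F.app _ a) (F.app _ b) := by
  obtain ⟨e, h₁, h₂⟩ := h
  exact ⟨_, h₁.map F, h₂.map F⟩

lemma ArrowIso.map {f g : C _⦋1⦌} (h : ArrowIso f g) (F : C ⟶ D) :
    ArrowIso (F.app _ f) (F.app _ g) := by
  obtain ⟨a, b, k, ha, hb, h₁, h₂⟩ := h
  exact ⟨_, _, _, ha.map F, hb.map F, h₁.map F, h₂.map F⟩

section HomotopyCategory

variable [Quasicategory C]

variable (C) in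
/-- The homotopy category of a quasicategory. -/
abbrev Ho := Truncated.HomotopyCategory₂ ((truncation 2).obj C)

/-- A vertex of `C` as an object of the homotopy category. -/
def Ho.of (a : C _⦋0⦌) : Ho C := ⟨a⟩

/-- The class of an edge in the homotopy category. -/
def cls {e : C _⦋1⦌} {a b : C _⦋0⦌} (h : IsHom e a b) : Ho.of a ⟶ Ho.of b :=
  Truncated.HomotopyCategory₂.homMk (Edge.mk e h.1 h.2).toTruncated

lemma exists_cls {a b : C _⦋0⦌} (f : Ho.of a ⟶ Ho.of b) :
    ∃ (e : C _⦋1⦌) (h : IsHom e a b), cls h = f := by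
  obtain ⟨e, rfl⟩ := Truncated.HomotopyCategory₂.homMk_surjective f
  exact ⟨e.edge, ⟨e.src_eq, e.tgt_eq⟩, rfl⟩

lemma cls_degenerate (a : C _⦋0⦌) : cls (isHom_degenerate a) = 𝟙 (Ho.of a) := rfl

/-- This is the dictionary for what follows: a goal about the existence of a 2-simplex becomes an
equation in an ordinary category. -/
lemma comp_iff {f g h : C _⦋1⦌} {a b c : C _⦋0⦌} (hf : IsHom f a b) (hg : IsHom g b c)
    (hh : IsHom h a c) : Comp f g h ↔ cls hf ≫ cls hg = cls hh := by
  refine Iff.trans ?_ Truncated.Edge.CompStruct.nonempty_iff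
  constructor
  · rintro ⟨σ, h2, h0, h1⟩
    exact ⟨⟨σ, h2, h0, h1⟩⟩
  · rintro ⟨s⟩
    exact ⟨s.simplex, s.d₂, s.d₀, s.d₁⟩

lemma Comp.cls_eq {f g h : C _⦋1⦌} {a b c : C _⦋0⦌} (H : Comp f g h) (hf : IsHom f a b)
    (hg : IsHom g b c) (hh : IsHom h a c) : cls hf ≫ cls hg = cls hh :=
  (comp_iff hf hg hh).1 H

lemma exists_comp {f g : C _⦋1⦌} (h : C.δ 0 f = C.δ 1 g) : ∃ k, Comp f g k := by
  obtain ⟨a, h2, h0⟩ := exists_horn_filler_two f g h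
  exact ⟨_, a, h2, h0, rfl⟩

lemma homotopic_iff {f g : C _⦋1⦌} {a b : C _⦋0⦌} (hf : IsHom f a b) (hg : IsHom g a b) :
    Homotopic f g ↔ cls hf = cls hg := by
  have := comp_iff hf (isHom_degenerate b) hg
  rw [cls_degenerate, Category.comp_id] at this
  rw [← this, Homotopic, hf.2]

lemma isEquivEdge_iff {e : C _⦋1⦌} {a b : C _⦋0⦌} (h : IsHom e a b) :
    IsEquivEdge e ↔ IsIso (cls h) := by
  constructor
  · rintro ⟨g, h₁, h₂⟩
    have hg : IsHom g b a := by
      refine ⟨?_, ?_⟩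
      · rw [← h₁.middle_eq, h.2]
      · rw [h₂.middle_eq, h.1]
    refine ⟨cls hg, ?_, ?_⟩
    · rw [h.1] at h₁
      exact h₁.cls_eq h hg (isHom_degenerate a)
    · rw [h.2] at h₂
      exact h₂.cls_eq hg h (isHom_degenerate b)
  · rintro ⟨g, h₁, h₂⟩
    obtain ⟨g, hg, rfl⟩ := exists_cls g
    refine ⟨g, ?_, ?_⟩
    · rw [h.1]
      exact (comp_iff h hg (isHom_degenerate a)).2 h₁
    · rw [h.2]
      exact (comp_iff hg h (isHom_degenerate b)).2 h₂

lemma equivalent_iff {a b : C _⦋0⦌} : Equivalent a b ↔ Nonempty (Ho.of a ≅ Ho.of b) := by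
  constructor
  · rintro ⟨e, h, he⟩
    have := (isEquivEdge_iff h).1 he
    exact ⟨asIso (cls h)⟩
  · rintro ⟨i⟩
    obtain ⟨e, h, he⟩ := exists_cls i.hom
    exact ⟨e, h, (isEquivEdge_iff h).2 (he ▸ inferInstance)⟩

lemma Equivalent.refl (a : C _⦋0⦌) : Equivalent a a := equivalent_iff.2 ⟨Iso.refl _⟩

lemma Equivalent.symm {a b : C _⦋0⦌} (h : Equivalent a b) : Equivalent b a := by
  obtain ⟨i⟩ := equivalent_iff.1 h
  exact equivalent_iff.2 ⟨i.symm⟩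

lemma Equivalent.trans {a b c : C _⦋0⦌} (h : Equivalent a b) (h' : Equivalent b c) :
    Equivalent a c := by
  obtain ⟨i⟩ := equivalent_iff.1 h
  obtain ⟨j⟩ := equivalent_iff.1 h'
  exact equivalent_iff.2 ⟨i ≪≫ j⟩

lemma arrowIso_iff {f g : C _⦋1⦌} {a b a' b' : C _⦋0⦌} (hf : IsHom f a b)
    (hg : IsHom g a' b') : ArrowIso f g ↔
      ∃ (i : Ho.of a ≅ Ho.of a') (j : Ho.of b ≅ Ho.of b'), i.hom ≫ cls hg = cls hf ≫ j.hom := by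
  constructor
  · rintro ⟨s, t, k, hs, ht, h₁, h₂⟩
    have hs' : IsHom s a a' := ⟨by rw [h₂.source_eq, ← h₁.source_eq, hf.1],
      by rw [h₂.middle_eq, hg.1]⟩
    have ht' : IsHom t b b' := ⟨by rw [← h₁.middle_eq, hf.2],
      by rw [h₁.target_eq, ← h₂.target_eq, hg.2]⟩
    have hk : IsHom k a b' := ⟨by rw [← h₁.source_eq, hf.1], by rw [← h₂.target_eq, hg.2]⟩
    have := (isEquivEdge_iff hs').1 hs
    have := (isEquivEdge_iff ht').1 ht
    refine ⟨asIso (cls hs'), asIso (cls ht'), ?_⟩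
    exact (h₂.cls_eq hs' hg hk).trans (h₁.cls_eq hf ht' hk).symm
  · rintro ⟨i, j, hij⟩
    obtain ⟨s, hs, hs'⟩ := exists_cls i.hom
    obtain ⟨t, ht, ht'⟩ := exists_cls j.hom
    obtain ⟨k, hk, hk'⟩ := exists_cls (cls hf ≫ j.hom)
    refine ⟨s, t, k, (isEquivEdge_iff hs).2 (hs' ▸ inferInstance),
      (isEquivEdge_iff ht).2 (ht' ▸ inferInstance), ?_, ?_⟩
    · rw [comp_iff hf ht hk, hk', ht']
    · rw [comp_iff hs hg hk, hk', hs', hij]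

lemma ArrowIso.trans {f g h : C _⦋1⦌} (H : ArrowIso f g) (H' : ArrowIso g h) :
    ArrowIso f h := by
  obtain ⟨i, j, e⟩ := (arrowIso_iff (isHom_self f) (isHom_self g)).1 H
  obtain ⟨i', j', e'⟩ := (arrowIso_iff (isHom_self g) (isHom_self h)).1 H'
  refine (arrowIso_iff (isHom_self f) (isHom_self h)).2 ⟨i ≪≫ i', j ≪≫ j', ?_⟩
  simp [e', reassoc_of% e]

lemma ArrowIso.symm {f g : C _⦋1⦌} (H : ArrowIso f g) : ArrowIso g f := by
  obtain ⟨i, j, e⟩ := (arrowIso_iff (isHom_self f) (isHom_self g)).1 H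
  refine (arrowIso_iff (isHom_self g) (isHom_self f)).2 ⟨i.symm, j.symm, ?_⟩
  simp [Iso.inv_comp_eq, reassoc_of% e]

lemma IsNullEdge.comp {f g h : C _⦋1⦌} (hf : IsNullEdge f) (H : Comp f g h) :
    IsNullEdge h := by
  obtain ⟨a, b, hz, hab⟩ := hf
  obtain ⟨k, hk⟩ := exists_comp (hab.target_eq.trans H.middle_eq)
  refine ⟨a, k, hz, ?_⟩
  have ha := isHom_self a
  have hb : IsHom b (C.δ 0 a) (C.δ 0 f) := ⟨hab.middle_eq.symm, hab.target_eq⟩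
  have hf : IsHom f (C.δ 1 a) (C.δ 0 f) := ⟨hab.source_eq.symm, rfl⟩
  have hg : IsHom g (C.δ 0 f) (C.δ 0 h) := ⟨H.middle_eq.symm, H.target_eq⟩
  have hh : IsHom h (C.δ 1 a) (C.δ 0 h) := ⟨by rw [← H.source_eq, ← hab.source_eq], rfl⟩
  have hk' : IsHom k (C.δ 0 a) (C.δ 0 h) := ⟨by rw [← hk.source_eq, hb.1],
    by rw [← hk.target_eq, hg.2]⟩
  rw [comp_iff ha hk' hh, ← hk.cls_eq hb hg hk', ← H.cls_eq hf hg hh, ← hab.cls_eq ha hb hf,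
    Category.assoc]

end HomotopyCategory

lemma IsNullEdge.map {f : C _⦋1⦌} (hf : IsNullEdge f) (F : C ⟶ D)
    (hF : ∀ x : C _⦋0⦌, IsZeroObj x → IsZeroObj (F.app _ x)) : IsNullEdge (F.app _ f) := by
  obtain ⟨a, b, hz, hab⟩ := hf
  exact ⟨_, _, by rw [← δ_naturality_apply]; exact hF _ hz, hab.map F⟩

end InfCat

/-! ### Décalage and slices under a vertex -/

namespace SSet

/-- The functor `[n] ↦ [0] ⋆ [n] = [n + 1]`, adding an initial vertex. -/
def cone : SimplexCategory ⥤ SimplexCategory where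
  obj n := ⦋n.len + 1⦌
  map f := SimplexCategory.mkHom
    ⟨Fin.cases 0 fun i => (f i).succ, fun i j hij => by
      induction i using Fin.cases with
      | zero => exact Fin.zero_le _
      | succ i =>
        induction j using Fin.cases with
        | zero => exact absurd hij (by simp)
        | succ j => exact Fin.succ_le_succ_iff.2 (f.toOrderHom.monotone (Fin.succ_le_succ_iff.1 hij))⟩
  map_id n := by
    ext i : 3
    induction i using Fin.cases <;> rfl
  map_comp f g := by
    ext i : 3
    induction i using Fin.cases <;> rfl

lemma cone_map_δ {n : ℕ} (i : Fin (n + 2)) :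
    cone.map (SimplexCategory.δ i) = SimplexCategory.δ i.succ := by
  ext j : 3
  induction j using Fin.cases with
  | zero => exact (Fin.succ_succAbove_zero i).symm
  | succ j => exact (Fin.succ_succAbove_succ i j).symm

/-- The inclusion `[n] ⟶ [0] ⋆ [n]`. -/
def coneInr : 𝟭 SimplexCategory ⟶ cone where
  app n := SimplexCategory.δ (n := n.len) 0
  naturality m n f := by
    ext i : 3
    rfl

/-- The décalage of a simplicial set: its `n`-simplices are the `(n+1)`-simplices, the initial
vertex being set apart. -/
def dec : SSet.{u} ⥤ SSet.{u} := (Functor.whiskeringLeft _ _ _).obj cone.op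

/-- Forgetting the initial vertex. -/
def decDrop : dec.{u} ⟶ 𝟭 _ where
  app X := Functor.whiskerRight (NatTrans.op coneInr) X
  naturality X Y f := by
    ext n x
    exact NatTrans.naturality_apply f (coneInr.app n.unop).op x |>.symm

variable (X : SSet.{u})

lemma dec_δ {n : ℕ} (i : Fin (n + 2)) (x : X _⦋n + 2⦌) :
    (dec.obj X).δ (n := n) i x = X.δ i.succ x := by
  change X.map (cone.map (SimplexCategory.δ i)).op x = _
  rw [cone_map_δ]
  rfl

/-- The slice of `X` under the vertex `x`. -/
def slice (x : X _⦋0⦌) : (dec.obj X).Subcomplex where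
  obj n := Set.ofPred fun a : X.obj (op (cone.obj n.unop)) =>
    X.map (SimplexCategory.const ⦋0⦌ (cone.obj n.unop) 0).op a = x
  map {n m} f a ha := by
    change X.map _ (X.map (cone.map f.unop).op a) = x
    refine (Functor.map_comp_apply X (cone.map f.unop).op
      (SimplexCategory.const ⦋0⦌ (cone.obj m.unop) 0).op a).symm.trans ?_
    exact ha

variable {X}

/-- Operators of the décalage fix the initial vertex, so membership in the slice can be tested on
any face, not only passed down to faces. -/
lemma mem_slice_map_iff {x : X _⦋0⦌} {n m : SimplexCategoryᵒᵖ} (f : n ⟶ m)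
    (a : (dec.obj X).obj n) :
    (dec.obj X).map f a ∈ (slice X x).obj m ↔ a ∈ (slice X x).obj n :=
  Eq.congr_left (z := x) (Functor.map_comp_apply X (cone.map f.unop).op
    (SimplexCategory.const ⦋0⦌ (cone.obj m.unop) 0).op a).symm

lemma mem_slice_δ_iff {x : X _⦋0⦌} {n : ℕ} (i : Fin (n + 2)) (a : X _⦋n + 2⦌) :
    X.δ i.succ a ∈ (slice X x).obj (op ⦋n⦌) ↔ a ∈ (slice X x).obj (op ⦋n + 1⦌) := by
  rw [← dec_δ]
  exact mem_slice_map_iff _ _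

lemma mem_slice_zero_iff {x : X _⦋0⦌} (a : X _⦋1⦌) :
    a ∈ (slice X x).obj (op ⦋0⦌) ↔ X.δ 1 a = x := by
  have : SimplexCategory.const ⦋0⦌ ⦋1⦌ 0 = SimplexCategory.δ 1 := by
    ext i : 3
    fin_cases i; rfl
  change X.map (SimplexCategory.const ⦋0⦌ ⦋1⦌ 0).op a = x ↔ _
  rw [this]
  exact Iff.rfl

lemma slice_faceCompatible {x : X _⦋0⦌} {n : ℕ} {u : Fin (n + 2) → (slice X x : SSet.{u}) _⦋n⦌}
    (hu : FaceCompatible u) (j k : Fin (n + 1)) (hjk : j ≤ k) :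
    X.δ (n := n) j.succ (u k.succ).1 = X.δ (n := n) k.succ (u j.castSucc).1 := by
  cases n with
  | zero =>
    -- Here `FaceCompatible` is vacuous; the identity holds because both edges start at `x`.
    obtain rfl : j = 0 := Fin.fin_one_eq_zero j
    obtain rfl : k = 0 := Fin.fin_one_eq_zero k
    exact ((mem_slice_zero_iff _).1 (u 1).2).trans ((mem_slice_zero_iff _).1 (u 0).2).symm
  | succ n =>
    exact ((dec_δ X j _).symm.trans (congrArg Subtype.val (hu j k hjk))).trans (dec_δ X k _)

/-- The functoriality of slices. -/
def sliceMap {Y : SSet.{u}} (g : X ⟶ Y) {x : X _⦋0⦌} {y : Y _⦋0⦌} (h : g.app _ x = y) :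
    (slice X x : SSet.{u}) ⟶ (slice Y y : SSet.{u}) :=
  Subcomplex.lift ((slice X x).ι ≫ dec.map g) (by
    rintro n _ ⟨⟨a, ha⟩, rfl⟩
    exact (NatTrans.naturality_apply g
      (SimplexCategory.const ⦋0⦌ (cone.obj n.unop) 0).op a).symm.trans ((congrArg _ ha).trans h))

/-- Forgetting the vertex of a slice. -/
def sliceDrop (x : X _⦋0⦌) : (slice X x : SSet.{u}) ⟶ X := (slice X x).ι ≫ decDrop.app X

/-- Forgetting the target of the edge `e` in the slice under `e`. -/
def sliceForget (e : X _⦋1⦌) {x : X _⦋0⦌} (h : X.δ 1 e = x) :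
    (slice (dec.obj X) (e : (dec.obj X) _⦋0⦌) : SSet.{u}) ⟶ (slice X x : SSet.{u}) :=
  Subcomplex.lift ((slice (dec.obj X) e).ι ≫ decDrop.app (dec.obj X)) (by
    rintro n _ ⟨⟨a, ha⟩, rfl⟩
    have key : SimplexCategory.const ⦋0⦌ (cone.obj n.unop) 0 ≫ cone.map (coneInr.app n.unop) =
        SimplexCategory.δ 1 ≫ cone.map (SimplexCategory.const ⦋0⦌ (cone.obj n.unop) 0) := by
      ext i : 3
      fin_cases i; rfl
    have key' := (Functor.map_comp_apply X (cone.map (coneInr.app n.unop)).op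
      (SimplexCategory.const ⦋0⦌ (cone.obj n.unop) 0).op a).symm.trans
      ((congrArg (fun f => X.map (Quiver.Hom.op f) a) key).trans (Functor.map_comp_apply X
        (cone.map (SimplexCategory.const ⦋0⦌ (cone.obj n.unop) 0)).op (SimplexCategory.δ 1).op a))
    exact key'.trans ((congrArg (X.δ 1) ha).trans h))

/-- Both composites forget the two vertices of `e`, in opposite orders. -/
lemma sliceForget_drop (e : X _⦋1⦌) {x y : X _⦋0⦌} (h : X.δ 1 e = x) (h' : X.δ 0 e = y) :
    sliceForget e h ≫ sliceDrop x = sliceMap (decDrop.app X) h' ≫ sliceDrop y :=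
  congrArg ((slice (dec.obj X) e).ι ≫ ·) (decDrop.naturality (decDrop.app X)).symm

/-- Both composites forget the vertices `1` and `2` of `τ`, in opposite orders. -/
lemma sliceForget_sliceForget (τ : X _⦋2⦌) {e f : X _⦋1⦌} {x : X _⦋0⦌} (he : X.δ 2 τ = e)
    (hf : X.δ 1 τ = f) (hex : X.δ 1 e = x) (hfx : X.δ 1 f = x) :
    sliceForget (X := dec.obj X) τ ((dec_δ X 1 τ).trans he) ≫ sliceForget e hex =
    sliceMap (X := dec.obj (dec.obj X)) (Y := dec.obj X) (x := τ) (y := f)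
      (decDrop.app (dec.obj X)) ((dec_δ X 0 τ).trans hf) ≫ sliceForget f hfx :=
  (cancel_mono (slice X x).ι).1
    (congrArg ((slice (dec.obj (dec.obj X)) τ).ι ≫ ·)
      (decDrop.naturality (decDrop.app (dec.obj X))).symm)

end SSet

/-! ### Trivial fibrations and initial objects -/

namespace SSet

variable {A B X : SSet.{u}}

/-- The hypotheses are lifting against the inclusions `∂Δ[n] → Δ[n]`, for `n = 0` and `n ≥ 1`; these
suffice for all monomorphisms. -/
lemma exists_lift_of_faces {p : A ⟶ B} (h0 : ∀ b : B _⦋0⦌, ∃ a : A _⦋0⦌, p.app _ a = b)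
    (h1 : ∀ (n : ℕ) (u : Fin (n + 2) → A _⦋n⦌), FaceCompatible u → ∀ b : B _⦋n + 1⦌,
      (∀ i, p.app _ (u i) = B.δ i b) → ∃ a : A _⦋n + 1⦌, (∀ i, A.δ i a = u i) ∧ p.app _ a = b) :
    (MorphismProperty.monomorphisms SSet.{u}).rlp p := by
  rw [rlp_monomorphisms]
  rintro _ _ _ ⟨n⟩
  refine ⟨fun {f g} sq => ?_⟩
  cases n with
  | zero =>
    obtain ⟨a, ha⟩ := h0 (yonedaEquiv g)
    refine ⟨⟨yonedaEquiv.symm a, boundary.hom_ext₀, ?_⟩⟩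
    rw [yonedaEquiv_symm_comp, ha, Equiv.symm_apply_apply]
  | succ n =>
    obtain ⟨a, ha, hb⟩ := h1 n _ (faceCompatible_of_hom f) (yonedaEquiv g) (fun i => by
      rw [← yonedaEquiv_comp, Category.assoc, sq.w, boundary.ι_ι_assoc,
        stdSimplex.yonedaEquiv_δ_comp])
    refine ⟨⟨yonedaEquiv.symm a, ?_, ?_⟩⟩
    · refine boundary.hom_ext fun i => ?_
      rw [boundary.ι_ι_assoc, stdSimplex.δ_comp_yonedaEquiv_symm, ha, Equiv.symm_apply_apply]
    · rw [yonedaEquiv_symm_comp, hb, Equiv.symm_apply_apply]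

lemma exists_of_rlp {p : A ⟶ B} (hp : (MorphismProperty.monomorphisms SSet.{u}).rlp p)
    (b : B _⦋0⦌) : ∃ a : A _⦋0⦌, p.app _ a = b := by
  have := hp (⊥ : (Δ[0] : SSet.{u}).Subcomplex).ι (.infer_property _)
  have sq : CommSq (Subcomplex.isInitialBot.to A) (⊥ : (Δ[0] : SSet.{u}).Subcomplex).ι p
    (yonedaEquiv.symm b) := ⟨Subcomplex.isInitialBot.hom_ext _ _⟩
  refine ⟨yonedaEquiv sq.lift, ?_⟩
  rw [← yonedaEquiv_comp, sq.fac_right, Equiv.apply_symm_apply]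

lemma exists_of_rlp_of_faces {p : A ⟶ B} (hp : (MorphismProperty.monomorphisms SSet.{u}).rlp p)
    {n : ℕ} {u : Fin (n + 2) → A _⦋n⦌} (hu : FaceCompatible u) (b : B _⦋n + 1⦌)
    (hub : ∀ i, p.app _ (u i) = B.δ i b) :
    ∃ a : A _⦋n + 1⦌, (∀ i, A.δ i a = u i) ∧ p.app _ a = b := by
  have := hp ∂Δ[n + 1].ι (.infer_property _)
  obtain ⟨φ, hφ⟩ := exists_boundary_desc u hu
  have sq : CommSq φ ∂Δ[n + 1].ι p (yonedaEquiv.symm b) := ⟨boundary.hom_ext fun i => by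
    rw [boundary.ι_ι_assoc, stdSimplex.δ_comp_yonedaEquiv_symm, reassoc_of% (hφ i),
      yonedaEquiv_symm_comp, hub]⟩
  refine ⟨yonedaEquiv sq.lift, fun i => ?_, ?_⟩
  · rw [← stdSimplex.yonedaEquiv_δ_comp, ← boundary.ι_ι, Category.assoc, sq.fac_left, hφ,
      Equiv.apply_symm_apply]
  · rw [← yonedaEquiv_comp, sq.fac_right, Equiv.apply_symm_apply]

end SSet

namespace InfCat

open SSet

variable {C : SSet.{u}}

lemma app_boundaryVertex {n : ℕ} (φ : (∂Δ[n + 1] : SSet) ⟶ C) (j : Fin (n + 2)) (k : Fin (n + 1)) :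
    φ.app _ (boundaryVertex n (j.succAbove k)) =
      C.map (SimplexCategory.const ⦋0⦌ ⦋n⦌ k).op (yonedaEquiv (boundary.ι j ≫ φ)) := by
  rw [yonedaEquiv_naturality, ← Category.assoc, yonedaEquiv_comp]
  congr 1

lemma isInitial_iff_faces (x : C _⦋0⦌) : IsInitial x ↔
    ∀ (n : ℕ) (f : Fin (n + 2) → C _⦋n⦌), FaceCompatible f →
      C.map (SimplexCategory.const ⦋0⦌ ⦋n⦌ 0).op (f (Fin.last _)) = x →
      ∃ a : C _⦋n + 1⦌, ∀ j, C.δ j a = f j := by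
  have key (n : ℕ) (φ : (∂Δ[n + 1] : SSet) ⟶ C) := app_boundaryVertex φ (Fin.last _) 0
  simp only [Fin.succAbove_last, Fin.castSucc_zero] at key
  constructor
  · intro hx n f hf h
    obtain ⟨φ, hφ⟩ := exists_boundary_desc f hf
    obtain ⟨ψ, hψ⟩ := hx n φ (by rw [key, hφ, Equiv.apply_symm_apply, h])
    refine ⟨yonedaEquiv ψ, fun j => ?_⟩
    rw [← stdSimplex.yonedaEquiv_δ_comp, ← boundary.ι_ι, Category.assoc, hψ, hφ,
      Equiv.apply_symm_apply]
  · intro hx n φ h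
    obtain ⟨a, ha⟩ := hx n _ (faceCompatible_of_hom φ) (by rw [← key, h])
    refine ⟨yonedaEquiv.symm a, boundary.hom_ext fun j => ?_⟩
    rw [boundary.ι_ι_assoc, stdSimplex.δ_comp_yonedaEquiv_symm, ha, Equiv.symm_apply_apply]

lemma isFinal_iff_faces (x : C _⦋0⦌) : IsFinal x ↔
    ∀ (n : ℕ) (f : Fin (n + 2) → C _⦋n⦌), FaceCompatible f →
      C.map (SimplexCategory.const ⦋0⦌ ⦋n⦌ (Fin.last n)).op (f 0) = x →
      ∃ a : C _⦋n + 1⦌, ∀ j, C.δ j a = f j := by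
  have key (n : ℕ) (φ : (∂Δ[n + 1] : SSet) ⟶ C) := app_boundaryVertex φ 0 (Fin.last _)
  simp only [Fin.succAbove_zero, Fin.succ_last] at key
  constructor
  · intro hx n f hf h
    obtain ⟨φ, hφ⟩ := exists_boundary_desc f hf
    obtain ⟨ψ, hψ⟩ := hx n φ (by rw [key, hφ, Equiv.apply_symm_apply, h])
    refine ⟨yonedaEquiv ψ, fun j => ?_⟩
    rw [← stdSimplex.yonedaEquiv_δ_comp, ← boundary.ι_ι, Category.assoc, hψ, hφ,
      Equiv.apply_symm_apply]
  · intro hx n φ h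
    obtain ⟨a, ha⟩ := hx n _ (faceCompatible_of_hom φ) (by rw [← key, h])
    refine ⟨yonedaEquiv.symm a, boundary.hom_ext fun j => ?_⟩
    rw [boundary.ι_ι_assoc, stdSimplex.δ_comp_yonedaEquiv_symm, ha, Equiv.symm_apply_apply]

/-- A lifting problem for `sliceDrop x` against a boundary inclusion is a sphere of one dimension
more with first vertex `x`: `b` is the face opposite `x`, and the simplices `v i` are the other
faces. -/
lemma IsInitial.rlp_sliceDrop {x : C _⦋0⦌} (hx : IsInitial x) :
    (MorphismProperty.monomorphisms SSet.{u}).rlp (sliceDrop x) := by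
  rw [isInitial_iff_faces] at hx
  refine exists_lift_of_faces (fun b => ?_) (fun n v hv b hb => ?_)
  · obtain ⟨a, ha⟩ := hx 0 ![b, x] trivial (by
      have : SimplexCategory.const ⦋0⦌ ⦋0⦌ 0 = 𝟙 _ := by
        ext i : 3
        fin_cases i; rfl
      rw [this, op_id, Functor.map_id_apply]
      rfl)
    exact ⟨⟨a, (mem_slice_zero_iff a).2 (ha 1)⟩, ha 0⟩
  · obtain ⟨a, ha⟩ := hx (n + 1) (Fin.cons b fun i => (v i).1) (fun j k hjk => by
        induction j using Fin.cases with
        | zero => exact hb k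
        | succ j =>
          induction k using Fin.cases with
          | zero => exact absurd hjk (by simp)
          | succ k =>
            exact slice_faceCompatible hv j k (Fin.succ_le_succ_iff.1 hjk))
      (v (Fin.last _)).2
    refine ⟨⟨a, (mem_slice_δ_iff 0 a).1 ?_⟩, fun i => Subtype.ext ?_, ha 0⟩
    · rw [ha]
      exact (v 0).2
    · exact (dec_δ C i a).trans (ha i.succ)

lemma isInitial_of_rlp_sliceDrop {x : C _⦋0⦌}
    (hx : (MorphismProperty.monomorphisms SSet.{u}).rlp (sliceDrop x)) : IsInitial x := by
  rw [isInitial_iff_faces]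
  intro n f hf h
  cases n with
  | zero =>
    have e : SimplexCategory.const ⦋0⦌ ⦋0⦌ 0 = 𝟙 _ := by
      ext i : 3
      fin_cases i; rfl
    rw [e, op_id, Functor.map_id_apply] at h
    obtain ⟨⟨a, ha⟩, hb⟩ := exists_of_rlp hx (f 0)
    refine ⟨a, fun j => ?_⟩
    fin_cases j
    · exact hb
    · exact ((mem_slice_zero_iff a).1 ha).trans h.symm
  | succ n =>
    -- The hypothesis `h` only speaks of the last face. Every face except the face `0` contains the
    -- vertex `0`, so the condition passes to them from the last face through common faces.
    have hmem : ∀ i : Fin (n + 2), f i.succ ∈ (slice C x).obj (op ⦋n⦌) := by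
      have hlast : f (Fin.last _) ∈ (slice C x).obj (op ⦋n⦌) := h
      intro i
      induction i using Fin.lastCases with
      | last => exact hlast
      | cast i =>
        cases n with
        | zero =>
          obtain rfl : i = 0 := Fin.fin_one_eq_zero i
          refine (mem_slice_zero_iff _).2 ?_
          exact (hf 1 1 le_rfl).symm.trans ((mem_slice_zero_iff _).1 hlast)
        | succ n =>
          have e : C.δ (Fin.last (n + 1)).succ (f i.castSucc.succ) = C.δ i.succ (f (Fin.last _)) :=
            (hf i.succ (Fin.last _) (Fin.le_last _)).symm
          have h' : C.δ i.succ (f (Fin.last _)) ∈ (slice C x).obj (op ⦋n⦌) :=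
            (mem_slice_δ_iff i _).2 hlast
          exact (mem_slice_δ_iff (Fin.last _) _).1 (by rwa [← e] at h')
    obtain ⟨⟨a, ha⟩, h1, h2⟩ := exists_of_rlp_of_faces hx (n := n)
      (u := fun i => ⟨f i.succ, hmem i⟩) (by
        cases n with
        | zero => trivial
        | succ n =>
          intro j k hjk
          refine Subtype.ext ?_
          refine (dec_δ C j _).trans (Eq.trans ?_ (dec_δ C k _).symm)
          exact hf j.succ k.succ (Fin.succ_le_succ_iff.2 hjk)) (f 0)
      (fun i => hf 0 i (Fin.zero_le _))
    refine ⟨a, fun j => ?_⟩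
    induction j using Fin.cases with
    | zero => exact h2
    | succ j => exact (dec_δ C j a).symm.trans (congrArg Subtype.val (h1 j))

end InfCat

/-! ### Trivial fibrations between slices of a quasicategory -/

namespace SSet

variable {X : SSet.{u}} [Quasicategory X]

/-- In a lifting problem the face `0` is `b` and the faces from `2` on are given by `e` or the `v
i`. Only the face `1` is missing, so this is an inner horn. -/
lemma rlp_sliceMap_decDrop {e : X _⦋1⦌} {x : X _⦋0⦌} (h : X.δ 0 e = x) :
    (MorphismProperty.monomorphisms SSet.{u}).rlp
      (sliceMap (X := dec.obj X) (x := e) (decDrop.app X) h) := by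
  refine exists_lift_of_faces (fun ⟨(b : X _⦋1⦌), hb⟩ => ?_)
    (fun n v hv ⟨(b : X _⦋n + 2⦌), hb⟩ hvb => ?_)
  · have hb' : X.δ 1 b = x := (mem_slice_zero_iff (X := X) b).1 hb
    obtain ⟨a, h2, h0⟩ := exists_horn_filler_two e b (h.trans hb'.symm)
    exact ⟨⟨a, (mem_slice_zero_iff (X := dec.obj X) a).2 ((dec_δ X 1 a).trans h2)⟩,
      Subtype.ext h0⟩
  · have hvb' (i) : X.δ (n := n + 1) 0 (v i).1 = X.δ i.succ b :=
      (congrArg Subtype.val (hvb i)).trans (dec_δ X i b)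
    let w (i : Fin (n + 2)) : X _⦋n + 2⦌ := (v i).1
    obtain ⟨a, ha⟩ := exists_horn_filler (X := X) (n := n + 1) (Fin.succ 0) (Fin.succ_pos _)
      (Fin.succ_lt_succ_iff.2 (Fin.last_pos (n := n + 1)))
      (Fin.cons b (Fin.cons b w)) (fun j k hjk hj hk => by
        induction k using Fin.cases with
        | zero => exact absurd rfl hk
        | succ k =>
        induction j using Fin.cases with
        | zero => exact hvb' k
        | succ j =>
        induction j using Fin.cases with
        | zero => exact absurd rfl hj
        | succ j =>
        induction k using Fin.cases with
        | zero => exact absurd (Fin.succ_le_succ_iff.1 hjk) (by simp)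
        | succ k =>
          have := slice_faceCompatible hv j k
            (Fin.succ_le_succ_iff.1 (Fin.succ_le_succ_iff.1 hjk))
          exact ((dec_δ X j.succ _).symm.trans this).trans (dec_δ X k.succ _))
    have ha' (i : Fin (n + 2)) : (dec.obj X).δ (n := n + 1) i.succ a = (v i).1 :=
      (dec_δ X i.succ a).trans (ha i.succ.succ ((Fin.succ_injective _).ne (Fin.succ_ne_zero _)))
    refine ⟨⟨a, (mem_slice_δ_iff (X := dec.obj X) 0 a).1 ?_⟩, fun i => Subtype.ext ?_,
      Subtype.ext (ha 0 (Fin.succ_ne_zero _).symm)⟩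
    · rw [ha']
      exact (v 0).2
    · exact (dec_δ (dec.obj X) i a).trans (ha' i)

/-- Now the face `1` and the faces from `3` on are given, and the faces `0` and `2` are missing. An
inner horn with index `1` is filled to produce the face `0`, called `β`; what remains is an inner
horn with index `2`. -/
lemma rlp_sliceMap_decDrop_dec {τ : X _⦋2⦌} {f : X _⦋1⦌} (h : X.δ 1 τ = f) :
    (MorphismProperty.monomorphisms SSet.{u}).rlp
      (sliceMap (X := dec.obj (dec.obj X)) (Y := dec.obj X) (x := τ) (y := f)
        (decDrop.app (dec.obj X)) ((dec_δ X 0 τ).trans h)) := by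
  refine exists_lift_of_faces (fun ⟨(b : X _⦋2⦌), hb⟩ => ?_)
    (fun n v hv ⟨(b : X _⦋n + 3⦌), hb⟩ hvb => ?_)
  · have hb : X.δ 2 b = f := (dec_δ X 1 b).symm.trans ((mem_slice_zero_iff (X := dec.obj X) b).1 hb)
    obtain ⟨β, h2, h0⟩ := exists_horn_filler_two (X.δ 0 τ) (X.δ 0 b) (by
      have e1 := X.δ_comp_δ_apply (i := 0) (j := 1) zero_le_one b
      have e2 := X.δ_comp_δ_apply (i := 0) (j := 0) le_rfl τ
      refine (e2.symm.trans (congrArg _ h)).trans (Eq.trans ?_ e1)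
      exact (congrArg _ hb).symm)
    obtain ⟨a, ha⟩ := exists_horn_filler (X := X) (n := 1) 2 (by decide) (by decide)
      ![β, b, b, τ] (fun j k hjk hj hk => by
        have h01 : X.δ 0 b = X.δ 0 β := h0.symm
        have h03 : X.δ 0 τ = X.δ 2 β := h2.symm
        have h13 : X.δ 1 τ = X.δ 2 b := h.trans hb.symm
        fin_cases j <;> fin_cases k <;> first | (exact h01) | (exact h03) | (exact h13) | simp_all)
    refine ⟨⟨a, (mem_slice_zero_iff (X := dec.obj (dec.obj X)) a).2 ?_⟩, Subtype.ext ?_⟩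
    · exact (dec_δ (dec.obj X) 1 a).trans ((dec_δ X 2 a).trans (ha 3 (by decide)))
    · exact (dec_δ X 0 a).trans (ha 1 (by decide))
  · let w (i : Fin (n + 2)) : X _⦋n + 3⦌ := (v i).1
    have hvb' (i) : X.δ (n := n + 2) (Fin.succ 0) (w i) = X.δ (n := n + 2) i.succ.succ b :=
      (dec_δ X 0 (v i).1).symm.trans ((congrArg Subtype.val (hvb i)).trans
        ((dec_δ (dec.obj X) i b).trans (dec_δ X i.succ b)))
    have hv' (j k : Fin (n + 1)) (hjk : j ≤ k) : X.δ (n := n + 2) j.succ.succ.succ (w k.succ) =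
        X.δ (n := n + 2) k.succ.succ.succ (w j.castSucc) := by
      have := slice_faceCompatible hv j k hjk
      exact (((dec_δ X j.succ.succ _).symm.trans (dec_δ (dec.obj X) j.succ _).symm).trans
        this).trans ((dec_δ (dec.obj X) k.succ _).trans (dec_δ X k.succ.succ _))
    obtain ⟨β, hβ⟩ := exists_horn_filler (X := X) (n := n + 1) (Fin.succ 0) (Fin.succ_pos _)
      (Fin.succ_lt_succ_iff.2 (Fin.last_pos (n := n + 1)))
      (Fin.cons (X.δ 0 b) (Fin.cons (X.δ 0 b) fun i => X.δ 0 (w i)))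
      (fun j k hjk hj hk => by
        induction k using Fin.cases with
        | zero => exact absurd rfl hk
        | succ k =>
        induction j using Fin.cases with
        | zero =>
          change X.δ 0 (X.δ 0 (w k)) = X.δ k.succ (X.δ 0 b)
          have e1 := X.δ_comp_δ_apply (i := 0) (j := k.succ) (Fin.zero_le _) b
          have e2 := X.δ_comp_δ_apply (i := 0) (j := 0) le_rfl (w k)
          refine e2.symm.trans (Eq.trans ?_ e1)
          exact congrArg _ (hvb' k)
        | succ j =>
        induction j using Fin.cases with
        | zero => exact absurd rfl hj
        | succ j =>
        induction k using Fin.cases with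
        | zero => exact absurd (Fin.succ_le_succ_iff.1 hjk) (by simp)
        | succ k =>
          change X.δ j.succ.succ (X.δ 0 (w k.succ)) = X.δ k.succ.succ (X.δ 0 (w j.castSucc))
          have e1 := X.δ_comp_δ_apply (i := 0) (j := j.succ.succ) (Fin.zero_le _) (w k.succ)
          have e2 := X.δ_comp_δ_apply (i := 0) (j := k.succ.succ) (Fin.zero_le _) (w j.castSucc)
          refine e1.symm.trans (Eq.trans ?_ e2)
          exact congrArg _ (hv' j k (Fin.succ_le_succ_iff.1 (Fin.succ_le_succ_iff.1 hjk))))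
    obtain ⟨a, ha⟩ := exists_horn_filler (X := X) (n := n + 2) (Fin.succ (Fin.succ 0))
      (Fin.succ_pos _)
      (Fin.succ_lt_succ_iff.2 (Fin.succ_lt_succ_iff.2 (Fin.last_pos (n := n + 1))))
      (Fin.cons β (Fin.cons b (Fin.cons b w)))
      (fun j k hjk hj hk => by
        induction k using Fin.cases with
        | zero =>
          obtain rfl : j = 0 := Fin.le_zero_iff.1 hjk
          exact (hβ 0 (Fin.succ_ne_zero _).symm).symm
        | succ k =>
        induction k using Fin.cases with
        | zero => exact absurd rfl hk
        | succ k =>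
        induction j using Fin.cases with
        | zero => exact (hβ k.succ.succ ((Fin.succ_injective _).ne (Fin.succ_ne_zero _))).symm
        | succ j =>
        induction j using Fin.cases with
        | zero => exact hvb' k
        | succ j =>
        induction j using Fin.cases with
        | zero => exact absurd rfl hj
        | succ j =>
        induction k using Fin.cases with
        | zero =>
          exact absurd (Fin.succ_le_succ_iff.1 (Fin.succ_le_succ_iff.1 hjk)) (by simp)
        | succ k =>
          exact hv' j k (Fin.succ_le_succ_iff.1 (Fin.succ_le_succ_iff.1
            (Fin.succ_le_succ_iff.1 hjk))))
    have ha' (i : Fin (n + 2)) : (dec.obj (dec.obj X)).δ (n := n + 1) i.succ a = (v i).1 :=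
      (dec_δ (dec.obj X) i.succ a).trans ((dec_δ X i.succ.succ a).trans
        (ha i.succ.succ.succ
          ((Fin.succ_injective _).ne ((Fin.succ_injective _).ne (Fin.succ_ne_zero _)))))
    refine ⟨⟨a, (mem_slice_δ_iff (X := dec.obj (dec.obj X)) 0 a).1 ?_⟩, fun i => Subtype.ext ?_,
      Subtype.ext ((dec_δ X 0 a).trans
        (ha (Fin.succ 0) ((Fin.succ_injective _).ne (Fin.succ_ne_zero _).symm)))⟩
    · rw [ha']
      exact (v 0).2
    · exact (dec_δ (dec.obj (dec.obj X)) i a).trans (ha' i)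

end SSet

/-! ### Retracts of initial and final objects -/

namespace SSet

/-- The collapse `[0] ⋆ [0] ⋆ [n] ⟶ [0] ⋆ [n]`. -/
def coneMul : cone ⋙ cone ⟶ cone where
  app n := SimplexCategory.σ (n := n.len + 1) 0
  naturality m n f := by
    ext i : 3
    induction i using Fin.cases with
    | zero => rfl
    | succ i =>
      induction i using Fin.cases with
      | zero => rfl
      | succ i => rfl

variable {X : SSet.{u}}

/-- The section of `sliceForget` at a degenerate edge. -/
def sliceDup (x : X _⦋0⦌) : (slice X x : SSet.{u}) ⟶
    (slice (dec.obj X) (X.σ 0 x : (dec.obj X) _⦋0⦌) : SSet.{u}) :=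
  Subcomplex.lift ((slice X x).ι ≫ Functor.whiskerRight (NatTrans.op coneMul) X) (by
    rintro n _ ⟨⟨a, ha⟩, rfl⟩
    have key : cone.map (SimplexCategory.const ⦋0⦌ (cone.obj n.unop) 0) ≫ coneMul.app n.unop =
        SimplexCategory.σ 0 ≫ SimplexCategory.const ⦋0⦌ (cone.obj n.unop) 0 := by
      ext i : 3
      fin_cases i <;> rfl
    have key' := (Functor.map_comp_apply X (coneMul.app n.unop).op
      (cone.map (SimplexCategory.const ⦋0⦌ (cone.obj n.unop) 0)).op a).symm.trans
      ((congrArg (fun f => X.map (Quiver.Hom.op f) a) key).trans (Functor.map_comp_apply X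
        (SimplexCategory.const ⦋0⦌ (cone.obj n.unop) 0).op (SimplexCategory.σ 0).op a))
    exact key'.trans (congrArg (X.σ 0) ha))

lemma sliceDup_sliceForget (x : X _⦋0⦌) (h : X.δ 1 (X.σ 0 x) = x) :
    sliceDup x ≫ sliceForget (X.σ 0 x) h = 𝟙 _ := by
  refine (cancel_mono (slice X x).ι).1 ?_
  have key (n : SimplexCategory) : cone.map (coneInr.app n) ≫ coneMul.app n = 𝟙 (cone.obj n) := by
    ext i : 3
    induction i using Fin.cases <;> rfl
  ext n ⟨a, ha⟩
  refine (Functor.map_comp_apply X (coneMul.app n.unop).op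
    (cone.map (coneInr.app n.unop)).op a).symm.trans ?_
  exact (congrArg (fun f => X.map (Quiver.Hom.op f) a) (key n.unop)).trans
    (Functor.map_id_apply X _ a)

end SSet

namespace SSet

lemma exists_comp_eq_of_rlp {A B : SSet.{u}} {p : A ⟶ B}
    (hp : (MorphismProperty.monomorphisms SSet.{u}).rlp p) {K : SSet.{u}} (g : K ⟶ B) :
    ∃ f : K ⟶ A, f ≫ p = g := by
  have := hp (⊥ : K.Subcomplex).ι (.infer_property _)
  have sq : CommSq (Subcomplex.isInitialBot.to A) (⊥ : K.Subcomplex).ι p g :=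
    ⟨Subcomplex.isInitialBot.hom_ext _ _⟩
  exact ⟨sq.lift, sq.fac_right⟩

end SSet

namespace InfCat

open SSet

/-- Write `e : x' → x` for `X.δ 2 τ`, with `x` initial; `τ` exhibits `x'` as a retract of `x`. To
solve a lifting problem for `sliceDrop x'`, one lifts its upper map to the slice under `e`, extends
the image in the slice under `x` because `x` is initial, lifts this extension back to the slice
under `e` along the trivial fibration `rlp_sliceMap_decDrop`, and forgets `x`. -/
lemma isInitial_of_retract {X : SSet.{u}} [Quasicategory X] {x' : X _⦋0⦌} {τ : X _⦋2⦌}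
    (h : X.δ 1 τ = X.σ 0 x') (hx : IsInitial (X.δ 0 (X.δ 2 τ))) : IsInitial x' := by
  have hdeg : X.δ 1 (X.σ 0 x') = x' := X.δ_comp_σ_succ_apply 0 x'
  have hx' : X.δ 1 (X.δ 2 τ) = x' := by
    have := X.δ_comp_δ_apply (i := 1) (j := 1) le_rfl τ
    refine (Eq.trans this ?_).trans hdeg
    exact congrArg _ h
  refine isInitial_of_rlp_sliceDrop fun A B i hi => ⟨fun {f t} sq => ?_⟩
  have hi' : Mono i := hi
  -- The retraction is used here: `f` first goes to the slice under the degenerate edge of `x'`,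
  -- then lifts to the slice under `τ`. Forgetting the last vertex of `τ` gives `f₃`, a lift of `f`
  -- to the slice under `X.δ 2 τ`.
  obtain ⟨f₂, hf₂⟩ := exists_comp_eq_of_rlp (rlp_sliceMap_decDrop_dec h) (f ≫ sliceDup x')
  let f₃ := f₂ ≫ sliceForget (X := dec.obj X) τ ((dec_δ X 1 τ).trans rfl)
  have hf₃ : f₃ ≫ sliceForget (X.δ 2 τ) hx' = f := by
    rw [Category.assoc, sliceForget_sliceForget τ rfl h hx' hdeg, reassoc_of% hf₂,
      sliceDup_sliceForget, Category.comp_id]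
  have lift₂ := hx.rlp_sliceDrop i hi
  have sq₂ : CommSq (f₃ ≫ sliceMap (X := dec.obj X) (x := X.δ 2 τ) (decDrop.app X) rfl) i
      (sliceDrop (X.δ 0 (X.δ 2 τ))) t :=
    ⟨(Category.assoc _ _ _).trans ((f₃ ≫= (sliceForget_drop (X.δ 2 τ) hx' rfl).symm).trans
      ((Category.assoc _ _ _).symm.trans ((hf₃ =≫ sliceDrop x').trans sq.w)))⟩
  obtain ⟨⟨⟨f₅, hf₅, hf₅'⟩⟩⟩ := lift₂.sq_hasLift sq₂
  have lift₃ := rlp_sliceMap_decDrop (e := X.δ 2 τ) rfl i hi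
  obtain ⟨⟨⟨f₆, hf₆, hf₆'⟩⟩⟩ := lift₃.sq_hasLift (CommSq.mk (f := f₃) (g := i)
    (h := sliceMap (X := dec.obj X) (x := X.δ 2 τ) (decDrop.app X) rfl) (i := f₅) hf₅.symm)
  refine ⟨⟨f₆ ≫ sliceForget (X.δ 2 τ) hx', ?_, ?_⟩⟩
  · rw [← Category.assoc, hf₆, hf₃]
  · exact (Category.assoc _ _ _).trans ((f₆ ≫= sliceForget_drop (X.δ 2 τ) hx' rfl).trans
      ((Category.assoc _ _ _).symm.trans ((hf₆' =≫ _).trans hf₅')))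

/-- The vertex condition of `isFinal_iff_faces` in the opposite simplicial set. -/
lemma op_map_const {C : SSet.{u}} {n : ℕ} (a : C _⦋n⦌) :
    C.op.map (SimplexCategory.const ⦋0⦌ ⦋n⦌ 0).op (opObjEquiv.symm a) =
      opObjEquiv.symm (C.map (SimplexCategory.const ⦋0⦌ ⦋n⦌ (Fin.last n)).op a) := by
  rw [op_map]
  have : SimplexCategory.rev.map (SimplexCategory.const ⦋0⦌ ⦋n⦌ 0) =
      SimplexCategory.const ⦋0⦌ ⦋n⦌ (Fin.last n) := by
    ext i : 3
    fin_cases i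
    exact Fin.rev_zero n
  exact congrArg (fun f => opObjEquiv.symm (C.map (Quiver.Hom.op f) a)) this

lemma faceCompatible_op {C : SSet.{u}} {n : ℕ} {f : Fin (n + 2) → C _⦋n⦌} (hf : FaceCompatible f) :
    FaceCompatible (X := C.op) fun i => opObjEquiv.symm (f i.rev) := by
  cases n with
  | zero => trivial
  | succ n =>
    intro j k hjk
    have := hf k.rev j.rev (Fin.rev_le_rev.2 hjk)
    rw [op_δ, op_δ]
    refine congrArg _ ?_
    rw [Equiv.apply_symm_apply, Equiv.apply_symm_apply, Fin.rev_succ, Fin.rev_castSucc]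
    exact this.symm

lemma faceCompatible_of_op {C : SSet.{u}} {n : ℕ} {f : Fin (n + 2) → C.op _⦋n⦌}
    (hf : FaceCompatible f) : FaceCompatible fun i => opObjEquiv (f i.rev) := by
  cases n with
  | zero => trivial
  | succ n =>
    intro j k hjk
    have := hf k.rev j.rev (Fin.rev_le_rev.2 hjk)
    rw [op_δ, op_δ, Fin.rev_rev, Fin.rev_rev] at this
    dsimp only
    rw [Fin.rev_succ, Fin.rev_castSucc]
    exact (opObjEquiv.symm.injective this).symm

lemma isInitial_op_iff {C : SSet.{u}} (x : C _⦋0⦌) :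
    IsInitial (C := C.op) (opObjEquiv.symm x) ↔ IsFinal x := by
  rw [isInitial_iff_faces, isFinal_iff_faces]
  constructor
  · intro hx n f hf h
    obtain ⟨a, ha⟩ := hx n _ (faceCompatible_op hf) (by
      rw [op_map_const, Fin.rev_last, h])
    refine ⟨opObjEquiv a, fun j => ?_⟩
    have := ha j.rev
    rw [op_δ, Fin.rev_rev] at this
    exact opObjEquiv.symm.injective this
  · intro hx n f hf h
    obtain ⟨a, ha⟩ := hx n _ (faceCompatible_of_op hf) (by
      rw [Fin.rev_zero]
      exact opObjEquiv.symm.injective ((op_map_const _).symm.trans h))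
    refine ⟨opObjEquiv.symm a, fun j => ?_⟩
    rw [op_δ, Equiv.apply_symm_apply, ha, Fin.rev_rev, Equiv.symm_apply_apply]

instance quasicategory_op {C : SSet.{u}} [Quasicategory C] : Quasicategory C.op := by
  refine quasicategory_of_filler _ fun n i σ h0 hn => ?_
  let Y (j : Fin (n + 3)) (h : j ≠ i) : C.op _⦋n + 1⦌ := yonedaEquiv (horn.ι i j h ≫ σ)
  have hY (j k : Fin (n + 2)) (hjk : j ≤ k) (hj : j.castSucc ≠ i) (hk : k.succ ≠ i) :
      C.op.δ j (Y k.succ hk) = C.op.δ k (Y j.castSucc hj) := by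
    have := (horn.IsCompatible.of_hom σ).δ_pred_comp j.castSucc k.succ hj hk
      (Fin.castSucc_lt_succ_iff.2 hjk)
    rw [Fin.pred_succ, Fin.castPred_castSucc] at this
    have := congrArg yonedaEquiv this
    rw [stdSimplex.yonedaEquiv_δ_comp, stdSimplex.yonedaEquiv_δ_comp] at this
    exact this.symm
  let y (j : Fin (n + 3)) : C _⦋n + 1⦌ :=
    if h : j.rev = i then opObjEquiv (Y 0 h0.ne) else opObjEquiv (Y j.rev h)
  have hy (j : Fin (n + 3)) (h : j.rev ≠ i) : y j = opObjEquiv (Y j.rev h) := dif_neg h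
  obtain ⟨a, ha⟩ := exists_horn_filler i.rev (by rwa [← Fin.rev_last, Fin.rev_lt_rev])
    (by rwa [← Fin.rev_zero, Fin.rev_lt_rev]) y (fun j k hjk hj hk => by
      have hj' : (j.rev).succ ≠ i := by rwa [← Fin.rev_castSucc, ne_eq, Fin.rev_eq_iff]
      have hk' : (k.rev).castSucc ≠ i := by rwa [← Fin.rev_succ, ne_eq, Fin.rev_eq_iff]
      have := hY k.rev j.rev (Fin.rev_le_rev.2 hjk) hk' hj'
      rw [op_δ, op_δ, Fin.rev_rev, Fin.rev_rev] at this
      rw [hy _ (by rwa [Fin.rev_succ]), hy _ (by rwa [Fin.rev_castSucc])]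
      simp only [Fin.rev_succ, Fin.rev_castSucc]
      exact (opObjEquiv.symm.injective this).symm)
  refine ⟨opObjEquiv.symm a, fun j hj => ?_⟩
  have hj' : j.rev.rev ≠ i := by rwa [Fin.rev_rev]
  rw [op_δ, Equiv.apply_symm_apply, ha _ (Fin.rev_injective.ne hj), hy _ hj',
    Equiv.symm_apply_apply]
  simp only [Fin.rev_rev]
  rfl

lemma isFinal_of_retract {X : SSet.{u}} [Quasicategory X] {x' : X _⦋0⦌} {τ : X _⦋2⦌}
    (h : X.δ 1 τ = X.σ 0 x') (hx : IsFinal (X.δ 0 (X.δ 2 τ))) : IsFinal x' := by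
  have h2 : X.δ 1 (X.δ 0 τ) = X.δ 0 (X.δ 2 τ) :=
    (X.δ_comp_δ_apply (i := 0) (j := 1) zero_le_one τ).symm
  rw [← isInitial_op_iff] at hx ⊢
  refine isInitial_of_retract (τ := opObjEquiv.symm τ) ?_ ?_
  · rw [op_δ, op_σ]
    exact congrArg _ h
  · rw [← h2] at hx
    rw [op_δ, op_δ]
    exact hx

end InfCat

/-! ### Zero objects, null edges and the weak universal property of a cofiber -/

namespace InfCat

open SSet

variable {C D : SSet.{u}}

lemma map_const_zero_op (e : C _⦋1⦌) :
    C.map (SimplexCategory.const ⦋0⦌ ⦋1⦌ 0).op e = C.δ 1 e := by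
  have : SimplexCategory.const ⦋0⦌ ⦋1⦌ 0 = SimplexCategory.δ 1 := by
    ext i : 3
    fin_cases i; rfl
  rw [this]
  rfl

lemma map_const_one_op (e : C _⦋1⦌) :
    C.map (SimplexCategory.const ⦋0⦌ ⦋1⦌ (Fin.last 1)).op e = C.δ 0 e := by
  have : SimplexCategory.const ⦋0⦌ ⦋1⦌ (Fin.last 1) = SimplexCategory.δ 0 := by
    ext i : 3
    fin_cases i; rfl
  rw [this]
  rfl

lemma map_const_self_op (x : C _⦋0⦌) :
    C.map (SimplexCategory.const ⦋0⦌ ⦋0⦌ 0).op x = x := by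
  have : SimplexCategory.const ⦋0⦌ ⦋0⦌ 0 = 𝟙 _ := by
    ext i : 3
    fin_cases i; rfl
  rw [this, op_id, Functor.map_id_apply]

lemma IsInitial.exists_isHom {x : C _⦋0⦌} (hx : IsInitial x) (y : C _⦋0⦌) :
    ∃ e : C _⦋1⦌, IsHom e x y := by
  rw [isInitial_iff_faces] at hx
  obtain ⟨a, ha⟩ := hx 0 ![y, x] trivial (map_const_self_op x)
  exact ⟨a, ha 1, ha 0⟩

lemma IsInitial.comp {x : C _⦋0⦌} (hx : IsInitial x) {f g h : C _⦋1⦌} (hf : C.δ 1 f = x)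
    (hfg : C.δ 0 f = C.δ 1 g) (hfh : C.δ 1 f = C.δ 1 h) (hgh : C.δ 0 g = C.δ 0 h) :
    Comp f g h := by
  rw [isInitial_iff_faces] at hx
  obtain ⟨a, ha⟩ := hx 1 ![g, h, f] (fun j k hjk => by
    fin_cases j <;> fin_cases k
    · exact hgh.symm
    · exact hfg
    · simp at hjk
    · exact hfh) ((map_const_zero_op f).trans hf)
  exact ⟨a, ha 2, ha 0, ha 1⟩

lemma IsFinal.comp {x : C _⦋0⦌} (hx : IsFinal x) {f g h : C _⦋1⦌} (hg : C.δ 0 g = x)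
    (hfg : C.δ 0 f = C.δ 1 g) (hfh : C.δ 1 f = C.δ 1 h) (hgh : C.δ 0 g = C.δ 0 h) :
    Comp f g h := by
  rw [isFinal_iff_faces] at hx
  obtain ⟨a, ha⟩ := hx 1 ![g, h, f] (fun j k hjk => by
    fin_cases j <;> fin_cases k
    · exact hgh.symm
    · exact hfg
    · simp at hjk
    · exact hfh) ((map_const_one_op g).trans hg)
  exact ⟨a, ha 2, ha 0, ha 1⟩

section

variable [Quasicategory C]

/-- Only one of the two inverse identities is used: it makes `a` a retract of `b`. -/
lemma IsZeroObj.of_equivalent {a b : C _⦋0⦌} (hb : IsZeroObj b) (h : Equivalent a b) :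
    IsZeroObj a := by
  obtain ⟨e, ⟨rfl, rfl⟩, g, ⟨τ, rfl, -, hτ⟩, -⟩ := h
  exact ⟨isInitial_of_retract hτ hb.1, isFinal_of_retract hτ hb.2⟩

lemma IsInitial.cls_eq {x y : C _⦋0⦌} (hx : IsInitial x) {f g : C _⦋1⦌} (hf : IsHom f x y)
    (hg : IsHom g x y) : cls hf = cls hg := by
  refine (homotopic_iff hf hg).1 (hx.comp hf.1 ?_ (hf.1.trans hg.1.symm) ?_)
  · exact (isHom_degenerate _).1.symm
  · exact (isHom_degenerate _).2.trans (hf.2.trans hg.2.symm)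

lemma IsFinal.cls_eq {x y : C _⦋0⦌} (hx : IsFinal x) {f g : C _⦋1⦌} (hf : IsHom f y x)
    (hg : IsHom g y x) : cls hf = cls hg := by
  have := (hx.comp (f := C.σ 0 y) hf.2 ((isHom_degenerate _).2.trans hf.1.symm)
    ((isHom_degenerate _).1.trans hg.1.symm) (hf.2.trans hg.2.symm)).cls_eq
    (isHom_degenerate y) hf hg
  rwa [cls_degenerate, Category.id_comp] at this

lemma IsZeroObj.equivalent {x y : C _⦋0⦌} (hx : IsZeroObj x) (hy : IsZeroObj y) :
    Equivalent x y := by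
  obtain ⟨e, he⟩ := hx.1.exists_isHom y
  obtain ⟨f, hf⟩ := hy.1.exists_isHom x
  obtain ⟨k, hk⟩ := exists_comp (he.2.trans hf.1.symm)
  obtain ⟨l, hl⟩ := exists_comp (hf.2.trans he.1.symm)
  have hk' : IsHom k x x := ⟨hk.source_eq.symm.trans he.1, hk.target_eq.symm.trans hf.2⟩
  have hl' : IsHom l y y := ⟨hl.source_eq.symm.trans hf.1, hl.target_eq.symm.trans he.2⟩
  exact equivalent_iff.2 ⟨⟨cls he, cls hf,
    (hk.cls_eq he hf hk').trans (hx.1.cls_eq hk' (isHom_degenerate x)),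
    (hl.cls_eq hf he hl').trans (hy.1.cls_eq hl' (isHom_degenerate y))⟩⟩

/-- A null edge factors through every zero object. -/
lemma IsNullEdge.exists_comp {m f : C _⦋1⦌} (hm : IsNullEdge m) (hf : C.δ 1 f = C.δ 1 m)
    (hz : IsZeroObj (C.δ 0 f)) : ∃ l, Comp f l m := by
  obtain ⟨a, b, hw, hab⟩ := hm
  have ha := isHom_self a
  have hb : IsHom b (C.δ 0 a) (C.δ 0 m) := ⟨hab.middle_eq.symm, hab.target_eq⟩
  have hm : IsHom m (C.δ 1 a) (C.δ 0 m) := ⟨hab.source_eq.symm, rfl⟩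
  have hf' : IsHom f (C.δ 1 a) (C.δ 0 f) := ⟨hf.trans hm.1, rfl⟩
  obtain ⟨l, hl⟩ := hz.1.exists_isHom (C.δ 0 m)
  obtain ⟨p, hp⟩ := hw.1.exists_isHom (C.δ 0 f)
  obtain ⟨q, hq⟩ := InfCat.exists_comp (hp.2.trans hl.1.symm)
  obtain ⟨r, hr⟩ := InfCat.exists_comp (ha.2.trans hp.1.symm)
  have hq' : IsHom q (C.δ 0 a) (C.δ 0 m) :=
    ⟨hq.source_eq.symm.trans hp.1, hq.target_eq.symm.trans hl.2⟩
  have hr' : IsHom r (C.δ 1 a) (C.δ 0 f) :=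
    ⟨hr.source_eq.symm.trans ha.1, hr.target_eq.symm.trans hp.2⟩
  refine ⟨l, (comp_iff hf' hl hm).2 ?_⟩
  rw [hz.2.cls_eq hf' hr', ← hr.cls_eq ha hp hr', Category.assoc, hq.cls_eq hp hl hq',
    hw.1.cls_eq hq' hb, hab.cls_eq ha hb hm]

end

/-- A simplex of `Δ[2]` avoiding the vertex `i` lies in the `i`-th face, so its image sees only that
face of `T`. -/
lemma yonedaEquiv_symm_app_eq {T T' : C _⦋2⦌} (i : Fin 3) (h : C.δ i T = C.δ i T')
    {d : SimplexCategoryᵒᵖ} (z : (Δ[2] : SSet.{u}).obj d)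
    (hz : z ∈ (stdSimplex.face {i}ᶜ : (Δ[2] : SSet.{u}).Subcomplex).obj d) :
    (yonedaEquiv.symm T).app d z = (yonedaEquiv.symm T').app d z := by
  rw [← stdSimplex.range_δ] at hz
  obtain ⟨w, rfl⟩ := hz
  have key (T : C _⦋2⦌) := ConcreteCategory.congr_hom (congr_app
    (stdSimplex.δ_comp_yonedaEquiv_symm T i) d) w
  refine (key T).trans (Eq.trans ?_ (key T').symm)
  rw [h]

/-- The map of vertices underlying `collapse`. -/
def collapseHom : Fin 5 →o Fin 3 := ⟨![0, 1, 1, 2, 2], by decide⟩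

/-- The collapse `Δ[4] ⟶ Δ[2]` identifying `1` with `2` and `3` with `4`. -/
def collapse : (Δ[4] : SSet.{u}) ⟶ Δ[2] :=
  SSet.stdSimplex.map (SimplexCategory.mkHom collapseHom)

/-- The piece of `boundaryJoinSpan 0` on the vertices `0`, `p` and `q`. -/
def spanPiece (p q : Bool) : (Δ[4] : SSet.{u}).Subcomplex :=
  stdSimplex.face {if p then 1 else 2}ᶜ ⊓ stdSimplex.face {if q then 3 else 4}ᶜ

lemma exists_spanPiece {d : SimplexCategoryᵒᵖ} {z : (Δ[4] : SSet.{u}).obj d}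
    (hz : z ∈ (boundaryJoinSpan 0).obj d) : ∃ i : Bool × Bool, z ∈ (spanPiece i.1 i.2).obj d := by
  obtain ⟨h₁, h₂⟩ := hz
  rw [Subfunctor.iSup_obj, Set.mem_iUnion] at h₂
  obtain ⟨i, h₂⟩ := h₂
  fin_cases i <;> obtain h₁ | h₁ := h₁
  · exact ⟨(true, true), h₁, h₂⟩
  · exact ⟨(false, true), h₁, h₂⟩
  · exact ⟨(true, false), h₁, h₂⟩
  · exact ⟨(false, false), h₁, h₂⟩

lemma collapse_mem_face_two {p p' : Bool} {n : ℕ} {z : (Δ[4] : SSet.{u}) _⦋n⦌} {q q' : Bool}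
    (h : z ∈ (spanPiece p q).obj _) (h' : z ∈ (spanPiece p' q').obj _) (hq : q ≠ q') :
    collapse.app _ z ∈ (stdSimplex.face {2}ᶜ : (Δ[2] : SSet.{u}).Subcomplex).obj _ := by
  have key : ∀ (q q' : Bool) (j : Fin 5), q ≠ q' → j ∈ ({if q then 3 else 4}ᶜ : Finset (Fin 5)) →
      j ∈ ({if q' then 3 else 4}ᶜ : Finset (Fin 5)) → collapseHom j ∈ ({2}ᶜ : Finset (Fin 3)) := by
    decide
  exact (stdSimplex.mem_face_iff _ _).2 fun i => key q q' (z i) hq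
    ((stdSimplex.mem_face_iff _ _).1 h.2 i) ((stdSimplex.mem_face_iff _ _).1 h'.2 i)

lemma collapse_mem_face_one {p p' : Bool} {n : ℕ} {z : (Δ[4] : SSet.{u}) _⦋n⦌} {q q' : Bool}
    (h : z ∈ (spanPiece p q).obj _) (h' : z ∈ (spanPiece p' q').obj _) (hp : p ≠ p') :
    collapse.app _ z ∈ (stdSimplex.face {1}ᶜ : (Δ[2] : SSet.{u}).Subcomplex).obj _ := by
  have key : ∀ (p p' : Bool) (j : Fin 5), p ≠ p' → j ∈ ({if p then 1 else 2}ᶜ : Finset (Fin 5)) →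
      j ∈ ({if p' then 1 else 2}ᶜ : Finset (Fin 5)) → collapseHom j ∈ ({1}ᶜ : Finset (Fin 3)) := by
    decide
  exact (stdSimplex.mem_face_iff _ _).2 fun i => key p p' (z i) hp
    ((stdSimplex.mem_face_iff _ _).1 h.1 i) ((stdSimplex.mem_face_iff _ _).1 h'.1 i)

/-- The complex `Λ^2_0 ⋆ ∂Δ^1` consists of four triangles from `0` through `1` or `2` to `3` or `4`.
The value `true` of `p` selects `2` and the value `true` of `q` selects `4`. Triangles with the same
`p` share their face `2`, those with the same `q` their face `1`; these are the only gluing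
conditions. -/
lemma exists_span_desc (T : Bool → Bool → C _⦋2⦌) (h2 : ∀ p, C.δ 2 (T p true) = C.δ 2 (T p false))
    (h1 : ∀ q, C.δ 1 (T true q) = C.δ 1 (T false q)) :
    ∃ φ : (boundaryJoinSpan 0 : SSet.{u}) ⟶ C, ∀ p q d z (h : z ∈ (boundaryJoinSpan 0).obj d),
      z ∈ (spanPiece p q).obj d →
        φ.app d ⟨z, h⟩ = (yonedaEquiv.symm (T p q)).app d (collapse.app d z) := by
  obtain ⟨φ, hφ⟩ := Subcomplex.exists_desc (boundaryJoinSpan 0)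
    (fun i : Bool × Bool => spanPiece i.1 i.2) (fun _ _ hz => exists_spanPiece hz)
    (fun i => (spanPiece i.1 i.2).ι ≫ collapse ≫ yonedaEquiv.symm (T i.1 i.2)) (by
      rintro ⟨p, q⟩ ⟨p', q'⟩ ⟨⟨n⟩⟩ z hi hj
      have e₂ : (yonedaEquiv.symm (T p q)).app (op ⦋n⦌) (collapse.app _ z) =
          (yonedaEquiv.symm (T p q')).app (op ⦋n⦌) (collapse.app _ z) := by
        by_cases hq : q = q'
        · rw [hq]
        · refine yonedaEquiv_symm_app_eq 2 ?_ _ (collapse_mem_face_two hi hj hq)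
          cases p <;> cases q <;> cases q' <;> simp_all
      refine e₂.trans ?_
      change (yonedaEquiv.symm (T p q')).app (op ⦋n⦌) (collapse.app _ z) =
        (yonedaEquiv.symm (T p' q')).app (op ⦋n⦌) (collapse.app _ z)
      by_cases hp : p = p'
      · rw [hp]
      · refine yonedaEquiv_symm_app_eq 1 ?_ _ (collapse_mem_face_one hi hj hp)
        cases q' <;> cases p <;> cases p' <;> simp_all)
  exact ⟨φ, fun p q d z h hz => hφ (p, q) d z h hz⟩

/-- The weak universal property of a cofiber. -/
lemma IsCofiberSeq.exists_comp [Quasicategory C] {t : Square C} (ht : IsCofiberSeq t)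
    {k m : C _⦋1⦌} (hk : Comp t.first k m) (hm : IsNullEdge m) : ∃ h, Comp t.second h k := by
  obtain ⟨T, hT2, hT0, hT1⟩ := hk
  have hc : C.δ 0 (C.δ 2 t.lower) = t.corner := C.δ_comp_δ_apply (i := 0) (j := 1) zero_le_one t.lower
  have hs : C.δ 1 (C.δ 2 t.lower) = C.δ 1 m := by
    have e1 := C.δ_comp_δ_apply (i := 1) (j := 1) le_rfl t.lower
    have e2 := C.δ_comp_δ_apply (i := 1) (j := 1) le_rfl t.upper
    have e3 := C.δ_comp_δ_apply (i := 1) (j := 1) le_rfl T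
    rw [← hT1]
    refine Eq.trans e1 (Eq.trans ?_ e3)
    refine (congrArg (C.δ 1) t.diag.symm).trans (Eq.trans e2.symm ?_)
    exact congrArg (C.δ 1) hT2.symm
  -- The null edge `m` factors through the zero corner of `t`. With `T`, this `T'` completes a
  -- second square on the span of `t`, with last corner the target of `k`.
  obtain ⟨l, T', hT'2, hT'0, hT'1⟩ := hm.exists_comp hs (hc ▸ ht.1)
  obtain ⟨φ, hφ⟩ := exists_span_desc
    (fun p q => if p then (if q then T' else t.lower) else (if q then T else t.upper))
    (by rintro (_ | _) <;> [exact hT2; exact hT'2])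
    (by rintro (_ | _) <;> [exact t.diag.symm; exact hT'1.trans hT1.symm])
  have hφ_id (p q : Bool) (z) (h) (hz : z ∈ (spanPiece p q).obj (op ⦋2⦌))
      (e : collapse.app _ z = yonedaEquiv (𝟙 _)) := (hφ p q _ z h hz).trans
    ((congrArg _ e).trans (yonedaEquiv_symm_app_id _))
  obtain ⟨ψ, hψ⟩ := ht.2 0 φ
    (hφ_id false false _ _ ⟨(stdSimplex.mem_face_iff _ _).2 (by decide),
        (stdSimplex.mem_face_iff _ _).2 (by decide)⟩ (by
      refine SSet.stdSimplex.ext _ _ fun i => ?_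
      fin_cases i <;> rfl))
    (hφ_id true false _ _ ⟨(stdSimplex.mem_face_iff _ _).2 (by decide),
        (stdSimplex.mem_face_iff _ _).2 (by decide)⟩ (by
      refine SSet.stdSimplex.ext _ _ fun i => ?_
      fin_cases i <;> rfl))
  -- In the image of the triangle `1 → 3 → 4`, the first edge is `t.second`, the long edge is `k`,
  -- and the edge `3 → 4` is the factorization sought.
  let z : (Δ[4] : SSet.{u}) _⦋2⦌ := stdSimplex.triangle 1 3 4 (by decide) (by decide)
  have hz : z ∈ (joinSpan 0).obj (op ⦋2⦌) := Or.inr ((stdSimplex.mem_face_iff _ _).2 (by decide))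
  have hz2 : Δ[4].δ 2 z ∈ (spanPiece false false).obj (op ⦋1⦌) :=
    ⟨(stdSimplex.mem_face_iff _ _).2 (by decide), (stdSimplex.mem_face_iff _ _).2 (by decide)⟩
  have hz1 : Δ[4].δ 1 z ∈ (spanPiece false true).obj (op ⦋1⦌) :=
    ⟨(stdSimplex.mem_face_iff _ _).2 (by decide), (stdSimplex.mem_face_iff _ _).2 (by decide)⟩
  have key (i j : Fin 3) (q : Bool) (hz' : Δ[4].δ i z ∈ (spanPiece false q).obj (op ⦋1⦌))
      (h : Δ[4].δ i z ∈ (boundaryJoinSpan 0).obj (op ⦋1⦌))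
      (e : collapse.app _ (Δ[4].δ i z) = Δ[2].δ j (yonedaEquiv (𝟙 _))) :
      C.δ i (ψ.app _ ⟨z, hz⟩) = C.δ j (if q then T else t.upper) := by
    refine (δ_naturality_apply ψ i _).symm.trans ?_
    refine (ConcreteCategory.congr_hom (congr_app hψ (op ⦋1⦌)) ⟨Δ[4].δ i z, h⟩).trans ?_
    refine (hφ false q _ _ h hz').trans ((congrArg _ e).trans ?_)
    refine (δ_naturality_apply _ j _).trans (congrArg _ ?_)
    exact yonedaEquiv_symm_app_id _
  refine ⟨C.δ 0 (ψ.app _ ⟨z, hz⟩), ψ.app _ ⟨z, hz⟩, ?_, rfl, ?_⟩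
  · refine key 2 0 false hz2 ⟨Or.inr hz2.1, ?_⟩ ?_
    · rw [Subfunctor.iSup_obj, Set.mem_iUnion]
      exact ⟨1, hz2.2⟩
    · refine SSet.stdSimplex.ext _ _ fun i => ?_
      fin_cases i <;> rfl
  · refine (key 1 0 true hz1 ⟨Or.inr hz1.1, ?_⟩ ?_).trans hT0
    · rw [Subfunctor.iSup_obj, Set.mem_iUnion]
      exact ⟨0, hz1.2⟩
    · refine SSet.stdSimplex.ext _ _ fun i => ?_
      fin_cases i <;> rfl

end InfCat

/-! ### Natural equivalences on objects and edges -/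

namespace InfCat

open SSet MonoidalCategory

variable {C D K : SSet.{u}}

lemma IsHom.comp_degenerate {e : C _⦋1⦌} {a b : C _⦋0⦌} (h : IsHom e a b) :
    Comp e (C.σ 0 b) e := by
  refine ⟨C.σ 1 e, C.δ_comp_σ_succ_apply 1 e, ?_, C.δ_comp_σ_self_apply 1 e⟩
  rw [← h.2]
  exact C.δ_comp_σ_of_le_apply (i := 0) (j := 0) le_rfl e

lemma IsHom.degenerate_comp {e : C _⦋1⦌} {a b : C _⦋0⦌} (h : IsHom e a b) :
    Comp (C.σ 0 a) e e := by
  refine ⟨C.σ 0 e, ?_, C.δ_comp_σ_self_apply 0 e, C.δ_comp_σ_succ_apply 0 e⟩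
  rw [← h.1]
  exact C.δ_comp_σ_of_gt_apply (i := 1) (j := 0) (by decide) e

lemma isEquivEdge_degenerate (a : C _⦋0⦌) : IsEquivEdge (C.σ 0 a) := by
  refine ⟨C.σ 0 a, ?_, ?_⟩
  · rw [(isHom_degenerate a).1]
    exact (isHom_degenerate a).comp_degenerate
  · rw [(isHom_degenerate a).2]
    exact (isHom_degenerate a).comp_degenerate

/-- A simplex of a product. -/
def pair {n : ℕ} (x : C _⦋n⦌) (y : K _⦋n⦌) : (C ⊗ K) _⦋n⦌ := (x, y)

lemma Comp.pair {f g h : C _⦋1⦌} {f' g' h' : K _⦋1⦌} (H : Comp f g h) (H' : Comp f' g' h') :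
    Comp (pair f f') (pair g g') (pair h h') := by
  obtain ⟨σ, rfl, rfl, rfl⟩ := H
  obtain ⟨τ, rfl, rfl, rfl⟩ := H'
  exact ⟨InfCat.pair σ τ, rfl, rfl, rfl⟩

lemma IsHom.pair {e : C _⦋1⦌} {a b : C _⦋0⦌} {e' : K _⦋1⦌} {a' b' : K _⦋0⦌} (h : IsHom e a b)
    (h' : IsHom e' a' b') : IsHom (pair e e') (pair a a') (pair b b') := by
  obtain ⟨rfl, rfl⟩ := h
  obtain ⟨rfl, rfl⟩ := h'
  exact ⟨rfl, rfl⟩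

lemma IsEquivEdge.pair {e : C _⦋1⦌} {e' : K _⦋1⦌} (h : IsEquivEdge e) (h' : IsEquivEdge e') :
    IsEquivEdge (pair e e') := by
  obtain ⟨g, h₁, h₂⟩ := h
  obtain ⟨g', h₁', h₂'⟩ := h'
  exact ⟨InfCat.pair g g', h₁.pair h₁', h₂.pair h₂'⟩

lemma isHom_coherentIso_hom :
    IsHom coherentIso.hom.{u}.edge coherentIso.x₀ coherentIso.x₁ :=
  ⟨coherentIso.hom.src_eq, coherentIso.hom.tgt_eq⟩

lemma isEquivEdge_coherentIso_hom : IsEquivEdge coherentIso.hom.{u}.edge := by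
  refine ⟨coherentIso.inv.edge, ?_, ?_⟩
  · rw [isHom_coherentIso_hom.1]
    exact ⟨_, coherentIso.homInvId.d₂, coherentIso.homInvId.d₀, coherentIso.homInvId.d₁⟩
  · rw [isHom_coherentIso_hom.2]
    exact ⟨_, coherentIso.invHomId.d₂, coherentIso.invHomId.d₀, coherentIso.invHomId.d₁⟩

lemma lift_const_app_zero (x : K _⦋0⦌) (a : C _⦋0⦌) :
    (CartesianMonoidalCategory.lift (𝟙 C) (SSet.const x)).app _ a = pair a x :=
  Prod.ext rfl (map_const_self_op x)

lemma lift_const_app_one (x : K _⦋0⦌) (e : C _⦋1⦌) :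
    (CartesianMonoidalCategory.lift (𝟙 C) (SSet.const x)).app _ e = pair e (K.σ 0 x) := by
  refine Prod.ext rfl ?_
  have : SimplexCategory.const ⦋1⦌ ⦋0⦌ 0 = SimplexCategory.σ 0 := by
    ext i : 3
    fin_cases i <;> rfl
  exact congrArg (fun f => K.map (Quiver.Hom.op f) x) this

/-- The component at `a` is the image of the identity of `a` paired with the generic isomorphism.
Both sides of the naturality square compose to the image of `e` paired with that isomorphism. -/
lemma NatEquivalent.exists_edges {F G : C ⟶ D} (h : NatEquivalent F G) :
    ∃ η : C _⦋0⦌ → D _⦋1⦌, (∀ a, IsHom (η a) (F.app _ a) (G.app _ a)) ∧ (∀ a, IsEquivEdge (η a)) ∧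
      ∀ (e : C _⦋1⦌) (a b : C _⦋0⦌), IsHom e a b →
        ∃ k, Comp (F.app _ e) (η b) k ∧ Comp (η a) (G.app _ e) k := by
  obtain ⟨H, rfl, rfl⟩ := h
  have hx (x : coherentIso.{u} _⦋0⦌) (a : C _⦋0⦌) :
      (CartesianMonoidalCategory.lift (𝟙 C) (SSet.const x) ≫ H).app _ a = H.app _ (pair a x) :=
    congrArg (H.app _) (lift_const_app_zero x a)
  have hx' (x : coherentIso.{u} _⦋0⦌) (a : C _⦋1⦌) :
      (CartesianMonoidalCategory.lift (𝟙 C) (SSet.const x) ≫ H).app _ a =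
        H.app _ (pair a (coherentIso.σ 0 x)) :=
    congrArg (H.app _) (lift_const_app_one x a)
  refine ⟨fun a => H.app _ (pair (C.σ 0 a) coherentIso.hom.edge), fun a => ?_, fun a => ?_,
    fun e a b he => ⟨H.app _ (pair e coherentIso.hom.edge), ?_, ?_⟩⟩
  · rw [hx, hx]
    exact ((isHom_degenerate a).pair isHom_coherentIso_hom).map H
  · exact ((isEquivEdge_degenerate a).pair isEquivEdge_coherentIso_hom).map H
  · rw [hx']
    exact (he.comp_degenerate.pair isHom_coherentIso_hom.degenerate_comp).map H
  · rw [hx']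
    exact (he.degenerate_comp.pair isHom_coherentIso_hom.comp_degenerate).map H

lemma NatEquivalent.equivalent {F G : C ⟶ D} (h : NatEquivalent F G) (a : C _⦋0⦌) :
    Equivalent (F.app _ a) (G.app _ a) := by
  obtain ⟨η, h₁, h₂, -⟩ := h.exists_edges
  exact ⟨η a, h₁ a, h₂ a⟩

lemma NatEquivalent.arrowIso {F G : C ⟶ D} (h : NatEquivalent F G) (e : C _⦋1⦌) :
    ArrowIso (F.app _ e) (G.app _ e) := by
  obtain ⟨η, -, h₂, h₃⟩ := h.exists_edges
  obtain ⟨k, hk, hk'⟩ := h₃ e _ _ (isHom_self e)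
  exact ⟨_, _, k, h₂ _, h₂ _, hk, hk'⟩

end InfCat

namespace InfCat

open SSet MonoidalCategory

variable {C D E : SSet.{u}}

lemma NatEquivalent.comp {F G : C ⟶ D} (h : NatEquivalent F G) (K : D ⟶ E) :
    NatEquivalent (F ≫ K) (G ≫ K) := by
  obtain ⟨H, rfl, rfl⟩ := h
  exact ⟨H ≫ K, (Category.assoc _ _ _).symm, (Category.assoc _ _ _).symm⟩

lemma exists_pi_simplex {ι : Type} {n : ℕ} (x : ι → C _⦋n⦌) :
    ∃ y : (∏ᶜ fun _ : ι => C) _⦋n⦌, ∀ i, (Limits.Pi.π (fun _ : ι => C) i).app _ y = x i := by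
  refine ⟨yonedaEquiv (Limits.Pi.lift fun i => yonedaEquiv.symm (x i)), fun i => ?_⟩
  rw [← yonedaEquiv_comp, Limits.Pi.lift_π, Equiv.apply_symm_apply]

lemma pi_simplex_ext {ι : Type} {n : ℕ} {x y : (∏ᶜ fun _ : ι => C) _⦋n⦌}
    (h : ∀ i, (Limits.Pi.π (fun _ : ι => C) i).app _ x = (Limits.Pi.π (fun _ : ι => C) i).app _ y) :
    x = y := by
  refine yonedaEquiv.symm.injective (Limits.Pi.hom_ext _ _ fun i => ?_)
  rw [yonedaEquiv_symm_comp, yonedaEquiv_symm_comp, h]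

end InfCat

/-! ### The Segal condition and stability of nilpotence under postcomposition -/

namespace GammaSSet

open InfCat SSet

variable {X Y : GammaSSet.{u}}

/-- The Segal map is an equivalence, so a tuple of edges out of the components of `a` lifts to an
edge out of `a` itself, with the targets correct up to equivalence. -/
lemma IsSymMon.exists_extension (hX : X.IsSymMon) {n : ℕ} (a : X.level n _⦋0⦌)
    (k : Fin n → X.underlying _⦋1⦌) (hk : ∀ i, X.underlying.δ 1 (k i) = comp i a) :
    ∃ w : X.level n _⦋1⦌, (X.level n).δ 1 w = a ∧
      ∀ i, ∃ u, IsEquivEdge u ∧ Comp (comp i w) u (k i) := by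
  have := hX.quasicategory n
  have : Quasicategory X.underlying := hX.quasicategory 1
  let S : X.level n ⟶ ∏ᶜ fun _ : Fin n => X.underlying :=
    Limits.Pi.lift fun i : Fin n => X.map (FinPt.proj i)
  have hS (i) : S ≫ Limits.Pi.π _ i = X.map (FinPt.proj i) := Limits.Pi.lift_π _ _
  have hS' (i) {d : ℕ} (x : X.level n _⦋d⦌) : (Limits.Pi.π (fun _ : Fin n => X.underlying) i).app _ (S.app _ x) = comp i x :=
    ConcreteCategory.congr_hom (congr_app (hS i) (op ⦋d⦌)) x
  obtain ⟨G, α, β⟩ := hX.segal n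
  obtain ⟨η, hη, hη', -⟩ := α.exists_edges
  have hβ (i) : NatEquivalent (G ≫ X.map (FinPt.proj i)) (Limits.Pi.π _ i) := by
    have := β.comp (Limits.Pi.π _ i)
    rwa [Category.assoc, hS, Category.id_comp] at this
  choose ε hε hε' hε'' using fun i => (hβ i).exists_edges
  have hA (i) : IsHom (comp i (η a)) (comp i (G.app _ (S.app _ a))) (comp i a) :=
    (hη a).map (X.map (FinPt.proj i))
  have hA' (i) : IsIso (cls (hA i)) := (isEquivEdge_iff _).1 ((hη' a).map _)
  have hB (i) : IsHom (ε i (S.app _ a)) (comp i (G.app _ (S.app _ a))) (comp i a) := by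
    have := hε i (S.app _ a)
    rwa [hS'] at this
  have hB' (i) : IsIso (cls (hB i)) := (isEquivEdge_iff _).1 (hε' i _)
  have hK (i) : IsHom (k i) (comp i a) (X.underlying.δ 0 (k i)) := ⟨hk i, rfl⟩
  -- The equivalences `η` and `ε` need not satisfy a triangle identity, so they may identify `comp i
  -- (G.app _ (S.app _ a))` with `comp i a` in two different ways. The edges `k i` are precomposed
  -- with the discrepancy so that it cancels at the end.
  choose k' hk' hkk' using fun i => exists_cls (inv (cls (hB i)) ≫ cls (hA i) ≫ cls (hK i))
  obtain ⟨κ, hκ⟩ := exists_pi_simplex k'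
  have hκ_hom (i) : IsHom ((Limits.Pi.π (fun _ : Fin n => X.underlying) i).app _ κ) (comp i a) (X.underlying.δ 0 (k i)) := by
    rw [hκ]
    exact hk' i
  have hκS : IsHom κ (S.app _ a) ((∏ᶜ fun _ : Fin n => X.underlying).δ 0 κ) := by
    refine ⟨pi_simplex_ext fun i => ?_, rfl⟩
    rw [δ_naturality_apply, (hκ_hom i).1]
    exact (hS' i a).symm
  obtain ⟨b, hb⟩ : ∃ b, b = (∏ᶜ fun _ : Fin n => X.underlying).δ 0 κ := ⟨_, rfl⟩
  rw [← hb] at hκS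
  have hbi (i) : (Limits.Pi.π (fun _ : Fin n => X.underlying) i).app _ b = X.underlying.δ 0 (k i) := by
    rw [hb, δ_naturality_apply, (hκ_hom i).2]
  have hGκ : IsHom (G.app _ κ) (G.app _ (S.app _ a)) (G.app _ b) := hκS.map G
  have hηa : IsHom (η a) (G.app _ (S.app _ a)) a := hη a
  have : IsIso (cls hηa) := (isEquivEdge_iff _).1 (hη' a)
  obtain ⟨w, hw, hw'⟩ := exists_cls (inv (cls hηa) ≫ cls hGκ)
  have H : Comp (η a) w (G.app _ κ) := by
    rw [comp_iff hηa hw hGκ, hw', IsIso.hom_inv_id_assoc]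
  refine ⟨w, hw.1, fun i => ⟨ε i b, hε' i b, ?_⟩⟩
  have hW : IsHom (comp i w) (comp i a) (comp i (G.app _ b)) := hw.map _
  have hBb : IsHom (ε i b) (comp i (G.app _ b)) (X.underlying.δ 0 (k i)) := by
    rw [← hbi]
    exact hε i b
  have hGκi : IsHom (comp i (G.app _ κ)) (comp i (G.app _ (S.app _ a))) (comp i (G.app _ b)) :=
    hGκ.map _
  obtain ⟨m, hm, hm'⟩ := hε'' i κ _ _ hκS
  have hm : Comp (comp i (G.app _ κ)) (ε i b) m := hm
  have hmh : IsHom m (comp i (G.app _ (S.app _ a))) (X.underlying.δ 0 (k i)) :=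
    ⟨hm.source_eq.symm.trans hGκi.1, hm.target_eq.symm.trans hBb.2⟩
  rw [hκ] at hm'
  have e1 := (H.map (X.map (FinPt.proj i))).cls_eq (hA i) hW hGκi
  have e2 := hm.cls_eq hGκi hBb hmh
  have e3 := hm'.cls_eq (hB i) (hk' i) hmh
  rw [comp_iff hW hBb (hK i), ← cancel_epi (cls (hA i))]
  refine (Category.assoc _ _ _).symm.trans ((congrArg (· ≫ cls hBb) e1).trans
    (e2.trans (e3.symm.trans ?_)))
  rw [hkk', IsIso.hom_inv_id_assoc]

/-- Componentwise postcomposition is realized by a single composite in `X⟨n⟩`, to which the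
multiplication can then be applied. -/
lemma IsSymMon.exists_comp (hX : X.IsSymMon) {n : ℕ} (q : X.level n _⦋1⦌)
    {f h g : Fin n → X.underlying _⦋1⦌} (hq : ∀ i, ArrowIso (comp i q) (f i))
    (H : ∀ i, Comp (f i) (h i) (g i)) :
    ∃ w q', Comp q w q' ∧ ∀ i, ArrowIso (comp i q') (g i) := by
  have := hX.quasicategory n
  have : Quasicategory X.underlying := hX.quasicategory 1
  have hqh (i) : IsHom (comp i q) (comp i ((X.level n).δ 1 q)) (comp i ((X.level n).δ 0 q)) :=
    (isHom_self q).map _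
  have hf (i) : IsHom (f i) (X.underlying.δ 1 (f i)) (X.underlying.δ 0 (f i)) := isHom_self _
  have hg (i) : IsHom (g i) (X.underlying.δ 1 (f i)) (X.underlying.δ 0 (g i)) :=
    ⟨(H i).source_eq.symm, rfl⟩
  have hh (i) : IsHom (h i) (X.underlying.δ 0 (f i)) (X.underlying.δ 0 (g i)) :=
    ⟨(H i).middle_eq.symm, (H i).target_eq⟩
  choose s t hst using fun i => (arrowIso_iff (hqh i) (hf i)).1 (hq i)
  choose k hk hk' using fun i => exists_cls ((t i).hom ≫ cls (hh i))
  obtain ⟨w, hw, hw'⟩ := hX.exists_extension ((X.level n).δ 0 q) k fun i => (hk i).1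
  obtain ⟨q', hq'⟩ := InfCat.exists_comp hw.symm
  refine ⟨w, q', hq', fun i => ?_⟩
  obtain ⟨u, hu, hu'⟩ := hw' i
  have hqi : Comp (comp i q) (comp i w) (comp i q') := hq'.map _
  have hw : IsHom (comp i w) (comp i ((X.level n).δ 0 q)) (X.underlying.δ 0 (comp i w)) :=
    ⟨hu'.source_eq.trans (hk i).1, rfl⟩
  have huh : IsHom u (X.underlying.δ 0 (comp i w)) (X.underlying.δ 0 (g i)) :=
    ⟨hu'.middle_eq.symm, hu'.target_eq.trans (hk i).2⟩
  have hq'h : IsHom (comp i q') (comp i ((X.level n).δ 1 q)) (X.underlying.δ 0 (comp i w)) :=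
    ⟨hqi.source_eq.symm.trans (hqh i).1, hqi.target_eq.symm⟩
  have := (isEquivEdge_iff huh).1 hu
  refine (arrowIso_iff hq'h (hg i)).2 ⟨s i, asIso (cls huh), ?_⟩
  have e1 := hqi.cls_eq (hqh i) hw hq'h
  have e2 := hu'.cls_eq hw huh (hk i)
  rw [asIso_hom, ← e1, ← (H i).cls_eq (hf i) (hh i) (hg i), reassoc_of% (hst i), Category.assoc,
    e2, hk']

/-- The tensor power of a composite is the composite of the tensor powers, and a composite with a
null edge is null. -/
lemma IsNilpotentEdge.of_comp (hX : X.IsSymMon) {f h g : X.underlying _⦋1⦌}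
    (hf : IsNilpotentEdge f) (H : Comp f h g) : IsNilpotentEdge g := by
  have : Quasicategory X.underlying := hX.quasicategory 1
  obtain ⟨n, hn, p, hp, hp'⟩ := hf
  obtain ⟨w, q, hq, hq'⟩ := hX.exists_comp p hp fun _ => H
  exact ⟨n, hn, q, hq', hp'.comp (hq.map (X.map (FinPt.fold n)))⟩

lemma TensorIsNilpotent.of_comp (hX : X.IsSymMon) {z : X.underlying _⦋0⦌}
    {f h g : X.underlying _⦋1⦌} (hf : TensorIsNilpotent z f) (H : Comp f h g) :
    TensorIsNilpotent z g := by
  obtain ⟨p, hp0, hp1, hp⟩ := hf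
  obtain ⟨w, q, hq, hq'⟩ := hX.exists_comp p (f := ![X.underlying.σ 0 z, f])
    (h := ![X.underlying.σ 0 z, h]) (g := ![X.underlying.σ 0 z, g])
    (fun i => by fin_cases i <;> assumption)
    (fun i => by fin_cases i <;> [exact (isHom_degenerate z).comp_degenerate; exact H])
  exact ⟨q, hq' 0, hq' 1, hp.of_comp hX (hq.map (X.map (FinPt.fold 2)))⟩

lemma TensorIsNilpotent.of_arrowIso (hX : X.IsSymMon) {z : X.underlying _⦋0⦌}
    {f g : X.underlying _⦋1⦌} (hf : TensorIsNilpotent z f) (H : ArrowIso f g) :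
    TensorIsNilpotent z g := by
  have : Quasicategory X.underlying := hX.quasicategory 1
  obtain ⟨p, hp0, hp1, hp⟩ := hf
  exact ⟨p, hp0, hp1.trans H, hp⟩

end GammaSSet

/-! ### Descent of simplices and equivalences to a finite stage -/

namespace GammaSSet

open InfCat SSet

/-- The action of a map of `Fin_*`-shaped diagrams on simplices. -/
abbrev onSimplex {X Y : GammaSSet.{u}} (F : X ⟶ Y) {n d : ℕ} (x : X.level n _⦋d⦌) :
    Y.level n _⦋d⦌ :=
  (F.app (FinPt.mk n)).app (op ⦋d⦌) x

section Eventually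

variable {J : Type u} [SmallCategory J]

/-- The property `P` of morphisms out of `k` holds after some morphism `k ⟶ l` and all its
prolongations. -/
def Eventually (k : J) (P : ∀ ⦃l : J⦄, (k ⟶ l) → Prop) : Prop :=
  ∃ (l : J) (f : k ⟶ l), ∀ ⦃m : J⦄ (g : l ⟶ m), P (f ≫ g)

variable {k : J} {P Q : ∀ ⦃l : J⦄, (k ⟶ l) → Prop}

lemma Eventually.and [IsFiltered J] (hP : Eventually k P) (hQ : Eventually k Q) :
    Eventually k fun _ f => P f ∧ Q f := by
  obtain ⟨l, f, hf⟩ := hP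
  obtain ⟨l', f', hf'⟩ := hQ
  obtain ⟨m, g, g', h⟩ := IsFiltered.span f f'
  refine ⟨m, f ≫ g, fun m' g'' => ⟨?_, ?_⟩⟩
  · rw [Category.assoc]
    exact hf _
  · rw [h, Category.assoc]
    exact hf' _

lemma Eventually.exists (hP : Eventually k P) : ∃ (l : J) (f : k ⟶ l), P f := by
  obtain ⟨l, f, hf⟩ := hP
  exact ⟨l, f ≫ 𝟙 l, hf _⟩

end Eventually

variable {J : Type u} [SmallCategory J] {D : J ⥤ GammaSSet.{u}} {c : Limits.Cocone D}

lemma onSimplex_map_comp {i j k : J} (f : i ⟶ j) (g : j ⟶ k) {n d : ℕ}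
    (x : (D.obj i).level n _⦋d⦌) :
    onSimplex (D.map (f ≫ g)) x = onSimplex (D.map g) (onSimplex (D.map f) x) := by
  rw [D.map_comp]
  rfl

lemma onSimplex_ι {i j : J} (f : i ⟶ j) {n d : ℕ} (x : (D.obj i).level n _⦋d⦌) :
    onSimplex (Y := c.pt) (c.ι.app j) (onSimplex (D.map f) x) = onSimplex (Y := c.pt) (c.ι.app i) x := by
  rw [← c.w f]
  rfl

lemma ι_desc_app {n d : ℕ} {j : J} (x : (D.obj j).level n _⦋d⦌) :
    ((Limits.colimit.desc D c).app (FinPt.mk n)).app _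
      (onSimplex ((Limits.colimit.cocone D).ι.app j) x) = onSimplex (Y := c.pt) (c.ι.app j) x := by
  rw [← Limits.colimit.ι_desc c j]
  rfl

/-- In this form an equivalence is finitely many simplices subject to finitely many equations, which
is what descends along a filtered colimit. -/
lemma equivalent_iff_simplices {C : SSet.{u}} (a b : C _⦋0⦌) : Equivalent a b ↔
    ∃ σ τ : C _⦋2⦌, (C.δ 1 (C.δ 2 σ) = a ∧ C.δ 0 (C.δ 2 σ) = b) ∧
      (C.δ 2 τ = C.δ 0 σ ∧ C.δ 0 τ = C.δ 2 σ) ∧ C.δ 1 σ = C.σ 0 a ∧ C.δ 1 τ = C.σ 0 b := by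
  constructor
  · rintro ⟨e, ⟨rfl, rfl⟩, g, ⟨σ, rfl, rfl, h⟩, ⟨τ, h₂, h₀, h₁⟩⟩
    exact ⟨σ, τ, ⟨rfl, rfl⟩, ⟨h₂, h₀⟩, h, h₁⟩
  · rintro ⟨σ, τ, ⟨rfl, rfl⟩, ⟨h₂, h₀⟩, h, h₁⟩
    exact ⟨C.δ 2 σ, ⟨rfl, rfl⟩, C.δ 0 σ, ⟨σ, rfl, rfl, h⟩, ⟨τ, h₂, h₀, h₁⟩⟩

/-- Evaluation at `⟨n⟩` and `d`. -/
abbrev evaluate (n d : ℕ) : GammaSSet.{u} ⥤ Type u :=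
  (evaluation _ _).obj (FinPt.mk n) ⋙ (evaluation _ _).obj (op ⦋d⦌)

lemma exists_rep (hc : Limits.IsColimit c) {n d : ℕ} (x : c.pt.level n _⦋d⦌) :
    ∃ (j : J) (y : (D.obj j).level n _⦋d⦌), onSimplex (Y := c.pt) (c.ι.app j) y = x :=
  Limits.Types.jointly_surjective _ (Limits.isColimitOfPreserves (evaluate n d) hc) x

lemma IsFilteredColimit.exists_equivalent (hc : IsFilteredColimit c) {n : ℕ}
    (x : c.pt.level n _⦋0⦌) : ∃ (j : J) (y : (D.obj j).level n _⦋0⦌),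
      Equivalent (onSimplex (Y := c.pt) (c.ι.app j) y) x := by
  obtain ⟨G, -, β⟩ := hc n
  obtain ⟨j, y, hy⟩ := exists_rep (Limits.colimit.isColimit D) (G.app _ x)
  refine ⟨j, y, ?_⟩
  rw [← ι_desc_app, hy]
  exact β.equivalent x

lemma IsFilteredColimit.exists_arrowIso (hc : IsFilteredColimit c) {n : ℕ}
    (x : c.pt.level n _⦋1⦌) : ∃ (j : J) (y : (D.obj j).level n _⦋1⦌),
      ArrowIso (onSimplex (Y := c.pt) (c.ι.app j) y) x := by
  obtain ⟨G, -, β⟩ := hc n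
  obtain ⟨j, y, hy⟩ := exists_rep (Limits.colimit.isColimit D) (G.app _ x)
  refine ⟨j, y, ?_⟩
  rw [← ι_desc_app, hy]
  exact β.arrowIso x

section

variable [IsFiltered J]

lemma eventually_eq (hc : Limits.IsColimit c) {n d : ℕ} {j : J} {x y : (D.obj j).level n _⦋d⦌}
    (h : onSimplex (Y := c.pt) (c.ι.app j) x = onSimplex (Y := c.pt) (c.ι.app j) y) :
    Eventually j fun _ f => onSimplex (D.map f) x = onSimplex (D.map f) y := by
  obtain ⟨k, f, g, hfg⟩ := (Limits.Types.FilteredColimit.isColimit_eq_iff _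
    (Limits.isColimitOfPreserves (evaluate n d) hc)).1 h
  have hfg : onSimplex (D.map f) x = onSimplex (D.map g) y := hfg
  -- The colimit equates the images of `x` and `y` along two possibly different morphisms `f` and
  -- `g`; coequalizing them yields a single morphism.
  refine ⟨_, f ≫ IsFiltered.coeqHom f g, fun l g' => ?_⟩
  have e : (f ≫ IsFiltered.coeqHom f g) ≫ g' = g ≫ IsFiltered.coeqHom f g ≫ g' := by
    rw [IsFiltered.coeq_condition, Category.assoc]
  change onSimplex (D.map ((f ≫ _) ≫ g')) x = onSimplex (D.map ((f ≫ _) ≫ g')) y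
  conv_rhs => rw [e]
  rw [Category.assoc, onSimplex_map_comp f, onSimplex_map_comp g, hfg]

lemma eventually_equivalent (hc : Limits.IsColimit c) {n : ℕ} {j : J}
    {a b : (D.obj j).level n _⦋0⦌}
    (h : Equivalent (onSimplex (Y := c.pt) (c.ι.app j) a) (onSimplex (Y := c.pt) (c.ι.app j) b)) :
    Eventually j fun _ f => Equivalent (onSimplex (D.map f) a) (onSimplex (D.map f) b) := by
  obtain ⟨σ, τ, h⟩ := (equivalent_iff_simplices _ _).1 h
  obtain ⟨i, σ, rfl⟩ := exists_rep hc σ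
  obtain ⟨i', τ, rfl⟩ := exists_rep hc τ
  obtain ⟨k, u, v, w, -⟩ : ∃ (k : J) (_ : j ⟶ k) (_ : i ⟶ k) (_ : i' ⟶ k), True :=
    ⟨_, IsFiltered.firstToMax₃ j i i', IsFiltered.secondToMax₃ j i i',
      IsFiltered.thirdToMax₃ j i i', trivial⟩
  rw [← onSimplex_ι u a, ← onSimplex_ι u b, ← onSimplex_ι v σ, ← onSimplex_ι w τ] at h
  simp only [← δ_naturality_apply, ← σ_naturality_apply] at h
  obtain ⟨⟨h₁, h₂⟩, ⟨h₃, h₄⟩, h₅, h₆⟩ := h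
  obtain ⟨l, f, hf⟩ := ((eventually_eq hc h₁).and (eventually_eq hc h₂)).and
    (((eventually_eq hc h₃).and (eventually_eq hc h₄)).and
      ((eventually_eq hc h₅).and (eventually_eq hc h₆)))
  refine ⟨l, u ≫ f, fun m g => (equivalent_iff_simplices _ _).2
    ⟨onSimplex (D.map (f ≫ g)) (onSimplex (D.map v) σ),
      onSimplex (D.map (f ≫ g)) (onSimplex (D.map w) τ), ?_⟩⟩
  have := hf g
  rw [Category.assoc, onSimplex_map_comp u, onSimplex_map_comp u]
  simpa only [← δ_naturality_apply, ← σ_naturality_apply] using this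

lemma IsFilteredColimit.eventually_equivalent (hc : IsFilteredColimit c) {n : ℕ}
    (hD : ∀ j, Quasicategory ((D.obj j).level n)) {j : J}
    {a b : (D.obj j).level n _⦋0⦌}
    (h : Equivalent (onSimplex (Y := c.pt) (c.ι.app j) a) (onSimplex (Y := c.pt) (c.ι.app j) b)) :
    Eventually j fun _ f => Equivalent (onSimplex (D.map f) a) (onSimplex (D.map f) b) := by
  obtain ⟨G, α, -⟩ := hc n
  let e := Limits.colimit.cocone D
  have he : Limits.IsColimit e := Limits.colimit.isColimit D
  obtain ⟨i, x, hx⟩ := exists_rep he (G.app _ (onSimplex (Y := c.pt) (c.ι.app j) a))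
  obtain ⟨i', y, hy⟩ := exists_rep he (G.app _ (onSimplex (Y := c.pt) (c.ι.app j) b))
  obtain ⟨k, u, v, w, -⟩ : ∃ (k : J) (_ : j ⟶ k) (_ : i ⟶ k) (_ : i' ⟶ k), True :=
    ⟨_, IsFiltered.firstToMax₃ j i i', IsFiltered.secondToMax₃ j i i',
      IsFiltered.thirdToMax₃ j i i', trivial⟩
  have hα (z : (D.obj j).level n _⦋0⦌) :
      Equivalent (G.app _ (onSimplex (Y := c.pt) (c.ι.app j) z)) (onSimplex (Y := e.pt) (e.ι.app j) z) := by
    rw [← ι_desc_app]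
    exact α.equivalent _
  have h₁ := hα a
  have h₂ := hα b
  have h₃ := h.map G
  rw [← hx, ← hy, ← onSimplex_ι v x, ← onSimplex_ι w y] at h₃
  rw [← hx, ← onSimplex_ι v x, ← onSimplex_ι u a] at h₁
  rw [← hy, ← onSimplex_ι w y, ← onSimplex_ι u b] at h₂
  -- The chain from `a` to `b` through `x` and `y` is an equivalence only in pieces: transitivity is
  -- applied at a stage, where the quasicategory hypothesis is at hand, so the three links descend
  -- separately.
  obtain ⟨l, f, hf⟩ := (GammaSSet.eventually_equivalent he h₁).and
    ((GammaSSet.eventually_equivalent he h₂).and (GammaSSet.eventually_equivalent he h₃))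
  refine ⟨l, u ≫ f, fun m g => ?_⟩
  obtain ⟨h₁, h₂, h₃⟩ := hf g
  rw [Category.assoc, onSimplex_map_comp u, onSimplex_map_comp u]
  have := hD m
  exact (h₁.symm.trans h₃).trans h₂

end

end GammaSSet

/-! ### Symmetric monoidal functors preserve duals and nilpotence -/

namespace GammaSSet

open InfCat SSet

variable {X Y : GammaSSet.{u}} (F : X ⟶ Y)

lemma onSimplex_act {n m : ℕ} (f : Fin n → Option (Fin m)) {d : ℕ} (x : X.level n _⦋d⦌) :
    onSimplex F (act f x) = act f (onSimplex F x) :=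
  ConcreteCategory.congr_hom (congr_app (F.naturality (FinPt.ofFun f)) (op ⦋d⦌)) x

lemma onSimplex_comp {n : ℕ} (i : Fin n) {d : ℕ} (x : X.level n _⦋d⦌) :
    onSimplex F (comp i x) = comp i (onSimplex F x) :=
  onSimplex_act F _ x

lemma onSimplex_mul {n d : ℕ} (x : X.level n _⦋d⦌) :
    onSimplex F (mul x) = mul (onSimplex F x) :=
  onSimplex_act F _ x

lemma onSimplex_unit (v : X.level 0 _⦋0⦌) : onSimplex F (unit v) = unit (onSimplex F v) :=
  onSimplex_act F _ v

lemma onSimplex_δ {n d : ℕ} (i : Fin (d + 2)) (x : X.level n _⦋d + 1⦌) :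
    onSimplex F ((X.level n).δ i x) = (Y.level n).δ i (onSimplex F x) :=
  δ_naturality_apply _ _ _

/-- Duality is witnessed by simplices and relations stable under every map of diagrams; exactness
plays no role. -/
lemma IsDual.map {x y : X.underlying _⦋0⦌} (h : IsDual x y) :
    IsDual (onSimplex F x) (onSimplex F y) := by
  obtain ⟨q, θ, c, e, e', f₁, f₂, g₁, g₂, k, h₁, h₂, h₃, h₄, h₅, h₆, h₇, h₈, h₉, h₁₀, h₁₁, h₁₂,
    h₁₃, h₁₄, h₁₅, h₁₆, h₁₇, h₁₈, h₁₉, h₂₀, h₂₁, h₂₂, h₂₃⟩ := h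
  have e1 {n m : ℕ} (f : Fin n → Option (Fin m)) {d : ℕ} (x : X.level n _⦋d⦌) :=
    onSimplex_act F f x
  have e2 {n : ℕ} (i : Fin n) {d : ℕ} (x : X.level n _⦋d⦌) := onSimplex_comp F i x
  have e3 {n d : ℕ} (x : X.level n _⦋d⦌) := onSimplex_mul F x
  have e4 (v : X.level 0 _⦋0⦌) := onSimplex_unit F v
  have e5 (x : X.underlying _⦋0⦌) : onSimplex F (X.underlying.σ 0 x) =
    Y.underlying.σ 0 (onSimplex F x) := σ_naturality_apply _ _ _
  have h₁ := h₁.map (F.app _)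
  have h₂ := h₂.map (F.app _)
  have h₃ := h₃.map (F.app _)
  have h₄ := h₄.map (F.app _)
  have h₅ := h₅.map (F.app _)
  have h₆ := h₆.map (F.app _)
  have h₇ := h₇.map (F.app _)
  have h₈ := h₈.map (F.app _)
  have h₉ := h₉.map (F.app _)
  have h₁₀ := h₁₀.map (F.app _)
  have h₁₁ := h₁₁.map (F.app _)
  have h₁₂ := h₁₂.map (F.app _)
  have h₁₃ := h₁₃.map (F.app _)
  have h₁₄ := h₁₄.map (F.app _)
  have h₁₅ := h₁₅.map (F.app _)
  have h₁₆ := h₁₆.map (F.app _)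
  have h₁₇ := h₁₇.map (F.app _)
  have h₁₈ := h₁₈.map (F.app _)
  have h₁₉ := h₁₉.map (F.app _)
  have h₂₀ := h₂₀.map (F.app _)
  have h₂₁ := h₂₁.map (F.app _)
  have h₂₂ := h₂₂.map (F.app _)
  have h₂₃ := h₂₃.map (F.app _)
  simp only [e1, e2, e3, e4, e5] at h₁ h₂ h₃ h₄ h₅ h₆ h₇ h₈ h₉ h₁₀ h₁₁ h₁₂
  simp only [e1, e2, e3, e5] at h₁₃ h₁₄ h₁₅ h₁₆ h₁₇ h₁₈ h₁₉ h₂₀ h₂₁ h₂₂ h₂₃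
  exact ⟨_, _, _, _, _, _, _, _, _, _, h₁, h₂, h₃, h₄, h₅, h₆, h₇, h₈, h₉, h₁₀, h₁₁, h₁₂,
    h₁₃, h₁₄, h₁₅, h₁₆, h₁₇, h₁₈, h₁₉, h₂₀, h₂₁, h₂₂, h₂₃⟩

lemma IsDual.of_equivalent [Quasicategory X.underlying] {x x' y : X.underlying _⦋0⦌}
    (h : IsDual x y) (hx : Equivalent x x') : IsDual x' y := by
  obtain ⟨q, θ, c, e, e', f₁, f₂, g₁, g₂, k, h₁, h⟩ := h
  exact ⟨q, θ, c, e, e', f₁, f₂, g₁, g₂, k, h₁.trans hx, h⟩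

variable {F}

lemma IsNilpotentObj.map (hF : IsExactFunctor F) {x : X.underlying _⦋0⦌} (h : IsNilpotentObj x) :
    IsNilpotentObj (onSimplex F x) := by
  obtain ⟨n, hn, p, hp, hp'⟩ := h
  refine ⟨n, hn, onSimplex F p, fun i => ?_, ?_⟩
  · rw [← onSimplex_comp]
    exact (hp i).map _
  · rw [← onSimplex_mul]
    exact hF.zero _ hp'

lemma IsNilpotentObj.of_equivalent [Quasicategory X.underlying] {x x' : X.underlying _⦋0⦌}
    (h : IsNilpotentObj x) (hx : Equivalent x x') : IsNilpotentObj x' := by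
  obtain ⟨n, hn, p, hp, hp'⟩ := h
  exact ⟨n, hn, p, fun i => (hp i).trans hx, hp'⟩

lemma IsNilpotentEdge.map (hF : IsExactFunctor F) {f : X.underlying _⦋1⦌}
    (h : IsNilpotentEdge f) : IsNilpotentEdge (onSimplex F f) := by
  obtain ⟨n, hn, p, hp, hp'⟩ := h
  refine ⟨n, hn, onSimplex F p, fun i => ?_, ?_⟩
  · rw [← onSimplex_comp]
    exact (hp i).map _
  · rw [← onSimplex_mul]
    exact hp'.map _ hF.zero

lemma TensorIsNilpotent.map (hF : IsExactFunctor F) {z : X.underlying _⦋0⦌}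
    {f : X.underlying _⦋1⦌} (h : TensorIsNilpotent z f) :
    TensorIsNilpotent (onSimplex F z) (onSimplex F f) := by
  obtain ⟨p, hp0, hp1, hp⟩ := h
  refine ⟨onSimplex F p, ?_, ?_, ?_⟩
  · rw [← onSimplex_comp, ← σ_naturality_apply]
    exact hp0.map _
  · rw [← onSimplex_comp]
    exact hp1.map _
  · rw [← onSimplex_mul]
    exact hp.map hF

end GammaSSet

/-! ### Triangles up to isomorphism of arrows -/

namespace InfCat

open SSet

variable {C : SSet.{u}}

lemma IsNullEdge.precomp [Quasicategory C] {f g h : C _⦋1⦌} (hg : IsNullEdge g) (H : Comp f g h) :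
    IsNullEdge h := by
  obtain ⟨a, b, hz, hab⟩ := hg
  obtain ⟨k, hk⟩ := InfCat.exists_comp (H.middle_eq.trans hab.source_eq.symm)
  have ha : IsHom a (C.δ 0 f) (C.δ 0 a) := ⟨hab.source_eq.trans H.middle_eq.symm, rfl⟩
  have hb : IsHom b (C.δ 0 a) (C.δ 0 g) := ⟨hab.middle_eq.symm, hab.target_eq⟩
  have hf := isHom_self f
  have hg : IsHom g (C.δ 0 f) (C.δ 0 g) := ⟨H.middle_eq.symm, rfl⟩
  have hh : IsHom h (C.δ 1 f) (C.δ 0 g) := ⟨H.source_eq.symm, H.target_eq.symm⟩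
  have hk' : IsHom k (C.δ 1 f) (C.δ 0 a) := ⟨hk.source_eq.symm, hk.target_eq.symm⟩
  refine ⟨k, b, by rwa [hk'.2], ?_⟩
  rw [comp_iff hk' hb hh, ← hk.cls_eq hf ha hk', ← H.cls_eq hf hg hh, ← hab.cls_eq ha hb hg,
    Category.assoc]

/-- The two maps of a triangle compose to a null edge. -/
lemma IsFiberSeq.exists_comp_null {s : Square C} (hs : IsFiberSeq s) :
    ∃ m, Comp s.first s.second m ∧ IsNullEdge m := by
  refine ⟨C.δ 1 s.upper, ⟨s.upper, rfl, rfl, rfl⟩, C.δ 2 s.lower, C.δ 0 s.lower, ?_,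
    s.lower, rfl, rfl, s.diag.symm⟩
  have : C.δ 0 (C.δ 2 s.lower) = s.corner := C.δ_comp_δ_apply (i := 0) (j := 1) zero_le_one s.lower
  rw [this]
  exact hs.1

lemma Comp.arrowIso_of_right {f g h : C _⦋1⦌} (H : Comp f g h) (hg : IsEquivEdge g) :
    ArrowIso f h :=
  ⟨_, g, h, isEquivEdge_degenerate _, hg, H, (isHom_self h).degenerate_comp⟩

lemma Comp.arrowIso_of_left {f g h : C _⦋1⦌} (H : Comp f g h) (hf : IsEquivEdge f) :
    ArrowIso h g :=
  ⟨f, _, h, hf, isEquivEdge_degenerate _, (isHom_self h).comp_degenerate, H⟩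

lemma ArrowIso.equivalent_target {f g : C _⦋1⦌} (h : ArrowIso f g) :
    Equivalent (C.δ 0 f) (C.δ 0 g) := by
  obtain ⟨a, b, k, -, hb, h₁, h₂⟩ := h
  exact ⟨b, ⟨h₁.middle_eq.symm, h₁.target_eq.trans h₂.target_eq.symm⟩, hb⟩

lemma Square.map_first {D : SSet.{u}} (F : C ⟶ D) (s : Square C) :
    (s.map F).first = F.app _ s.first :=
  (δ_naturality_apply F 2 s.upper).symm

lemma Square.map_second {D : SSet.{u}} (F : C ⟶ D) (s : Square C) :
    (s.map F).second = F.app _ s.second :=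
  (δ_naturality_apply F 0 s.upper).symm

/-- If `f` is identified with `s.first` by equivalences `a` and `b`, then `k` is `s.second`
precomposed with `b`. Its composite with `f` is that of the triangle precomposed with `a`, hence
null. -/
lemma IsFiberSeq.exists_null_comp_of_arrowIso [Quasicategory C] {s : Square C} (hs : IsFiberSeq s)
    {f : C _⦋1⦌} (hf : ArrowIso f s.first) :
    ∃ k m, Comp f k m ∧ IsNullEdge m ∧ ArrowIso k s.second := by
  obtain ⟨m₀, hm₀, hm₀'⟩ := hs.exists_comp_null
  obtain ⟨a, b, h, ha, hb, h₁, h₂⟩ := hf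
  obtain ⟨k, hk⟩ := InfCat.exists_comp (f := b) (g := s.second)
    (h₁.target_eq.trans (h₂.target_eq.symm.trans hm₀.middle_eq))
  obtain ⟨m, hm⟩ := InfCat.exists_comp (h₂.middle_eq.trans hm₀.source_eq)
  refine ⟨k, m, ?_, hm₀'.precomp hm, hk.arrowIso_of_left hb⟩
  have hs' : IsHom s.second (C.δ 0 h) (C.δ 0 k) :=
    ⟨hm₀.middle_eq.symm.trans h₂.target_eq, hk.target_eq⟩
  have hfh : IsHom f (C.δ 1 h) (C.δ 0 f) := ⟨h₁.source_eq, rfl⟩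
  have hbh : IsHom b (C.δ 0 f) (C.δ 0 h) := ⟨h₁.middle_eq.symm, h₁.target_eq⟩
  have hah : IsHom a (C.δ 1 h) (C.δ 0 a) := ⟨h₂.source_eq, rfl⟩
  have hsh : IsHom s.first (C.δ 0 a) (C.δ 0 h) := ⟨h₂.middle_eq.symm, h₂.target_eq⟩
  have hkh : IsHom k (C.δ 0 f) (C.δ 0 k) := ⟨hk.source_eq.symm.trans hbh.1, rfl⟩
  have hm₀h : IsHom m₀ (C.δ 0 a) (C.δ 0 k) :=
    ⟨hm₀.source_eq.symm.trans hsh.1, hm₀.target_eq.symm.trans hs'.2⟩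
  have hmh : IsHom m (C.δ 1 h) (C.δ 0 k) :=
    ⟨hm.source_eq.symm.trans hah.1, hm.target_eq.symm.trans hm₀h.2⟩
  rw [comp_iff hfh hkh hmh, ← hk.cls_eq hbh hs' hkh, ← hm.cls_eq hah hm₀h hmh,
    ← hm₀.cls_eq hsh hs' hm₀h, ← Category.assoc, ← Category.assoc,
    h₁.cls_eq hfh hbh (isHom_self h), h₂.cls_eq hah hsh (isHom_self h)]

end InfCat

/-! ### The colimit is local, rigid and satisfies exact-nilpotence -/

namespace GammaSSet

open InfCat SSet

variable {J : Type u} [SmallCategory J] [IsFiltered J] {D : J ⥤ GammaSSet.{u}}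
  {c : Limits.Cocone D}

/-- The image of `x` is equivalent to the image of a zero object `z` of the same stage. This
equivalence descends to some `k`, and the local functor to `k` reflects the vanishing of `x`.
Locality of the transition functors enters the proof only here. -/
lemma IsFilteredColimit.isZeroObj (hc : IsFilteredColimit c)
    (hD : ∀ j, (D.obj j).IsSymMonStable)
    (hexact : ∀ {i j : J} (f : i ⟶ j), GammaSSet.IsExactFunctor (D.map f))
    (hlocal : ∀ {i j : J} (f : i ⟶ j), GammaSSet.IsLocalFunctor (D.map f))
    (hpt : c.pt.IsSymMonStable)
    (hleg : ∀ j, GammaSSet.IsExactFunctor (c.ι.app j)) {j : J} {x : (D.obj j).underlying _⦋0⦌}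
    (hx : IsZeroObj (onSimplex (Y := c.pt) (c.ι.app j) x)) : IsZeroObj x := by
  obtain ⟨z, hz⟩ := (hD j).stable.exists_zero
  have := hpt.stable.quasicategory
  obtain ⟨k, f, hf⟩ := (hc.eventually_equivalent (fun j => (hD j).stable.quasicategory)
    (hx.equivalent ((hleg j).zero z hz))).exists
  have := (hD k).stable.quasicategory
  exact (hlocal f x).1 (((hexact f).zero z hz).of_equivalent hf)

/-- Every map to the unit of the colimit comes from a map to the unit at some stage. -/
lemma IsFilteredColimit.exists_arrowIso_unit (hc : IsFilteredColimit c)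
    (hD : ∀ j, Quasicategory (D.obj j).underlying) (hpt : Quasicategory c.pt.underlying)
    {v : c.pt.level 0 _⦋0⦌} {g : c.pt.underlying _⦋1⦌} (hg : c.pt.underlying.δ 0 g = unit v) :
    ∃ (j : J) (w : (D.obj j).level 0 _⦋0⦌) (e : (D.obj j).underlying _⦋1⦌),
      (D.obj j).underlying.δ 0 e = unit w ∧ ArrowIso (onSimplex (Y := c.pt) (c.ι.app j) e) g := by
  obtain ⟨i, e₀, he⟩ := hc.exists_arrowIso g
  obtain ⟨i', w₀, hw⟩ := hc.exists_equivalent v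
  obtain ⟨j, f, f', -⟩ : ∃ (j : J) (_ : i ⟶ j) (_ : i' ⟶ j), True :=
    ⟨_, IsFiltered.leftToMax i i', IsFiltered.rightToMax i i', trivial⟩
  rw [← onSimplex_ι f e₀] at he
  rw [← onSimplex_ι f' w₀] at hw
  generalize onSimplex (D.map f) e₀ = e at he
  generalize onSimplex (D.map f') w₀ = w at hw
  have h : Equivalent (onSimplex (Y := c.pt) (c.ι.app j) ((D.obj j).underlying.δ 0 e))
      (onSimplex (Y := c.pt) (c.ι.app j) (unit w)) := by
    rw [onSimplex_unit, onSimplex_δ]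
    exact he.equivalent_target.trans (hg ▸ (hw.map (c.pt.map (FinPt.fold 0))).symm)
  obtain ⟨l, k, u, hu, hu'⟩ := (hc.eventually_equivalent hD h).exists
  rw [onSimplex_unit, onSimplex_δ] at hu
  -- The target of `e` is so far only equivalent to the unit; composing with `u` makes it literally
  -- a unit, without changing the isomorphism class of the arrow.
  obtain ⟨e', he'⟩ := InfCat.exists_comp hu.1.symm
  refine ⟨l, onSimplex (D.map k) w, e', he'.target_eq.symm.trans hu.2, ?_⟩
  rw [← onSimplex_ι k e] at he
  exact ((he'.arrowIso_of_right hu').map _).symm.trans he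

lemma IsFilteredColimit.isLocalTTCat (hc : IsFilteredColimit c)
    (hD : ∀ j, (D.obj j).IsLocalTTCat)
    (hexact : ∀ {i j : J} (f : i ⟶ j), IsExactFunctor (D.map f))
    (hlocal : ∀ {i j : J} (f : i ⟶ j), IsLocalFunctor (D.map f))
    (hpt : c.pt.IsSymMonStable) (hleg : ∀ j, IsExactFunctor (c.ι.app j)) :
    c.pt.IsLocalTTCat := by
  have hqD (j : J) : Quasicategory (D.obj j).underlying := (hD j).stable.quasicategory
  have hqpt : Quasicategory c.pt.underlying := hpt.stable.quasicategory
  have hzero {j : J} {x : (D.obj j).underlying _⦋0⦌} (hx : IsZeroObj (onSimplex (Y := c.pt) (c.ι.app j) x)) :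
      IsZeroObj x :=
    hc.isZeroObj (fun j => (hD j).toIsSymMonStable) hexact hlocal hpt hleg hx
  refine { toIsSymMonStable := hpt, rigid := fun x => ?_, nonzero := ?_, nilpotent := ?_ }
  · obtain ⟨j, y, hy⟩ := hc.exists_equivalent x
    obtain ⟨y', hy'⟩ := (hD j).rigid y
    exact ⟨_, (hy'.map (Y := c.pt) (c.ι.app j)).of_equivalent hy⟩
  · obtain ⟨j⟩ := IsFiltered.nonempty (C := J)
    obtain ⟨x, hx⟩ := (hD j).nonzero
    exact ⟨_, fun h => hx (hzero h)⟩
  · rintro x y ⟨p, hpx, hpy, hp⟩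
    -- The object `p` of `X⟨2⟩` carries both factors and their product, so descending it descends
    -- all three coherently.
    obtain ⟨j, q, hq⟩ := hc.exists_equivalent p
    have hq' (i : Fin 2) : Equivalent (onSimplex (Y := c.pt) (c.ι.app j) (comp i q)) (comp i p) := by
      rw [onSimplex_comp]
      exact hq.map _
    have hmul : IsZeroObj (mul q) := by
      refine hzero (hp.of_equivalent ?_)
      rw [onSimplex_mul]
      exact hq.map _
    exact ((hD j).nilpotent _ _ ⟨q, Equivalent.refl _, Equivalent.refl _, hmul⟩).imp
      (fun h => (h.map (Y := c.pt) (hleg j)).of_equivalent ((hq' 0).trans hpx))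
      (fun h => (h.map (Y := c.pt) (hleg j)).of_equivalent ((hq' 1).trans hpy))

lemma IsFilteredColimit.exactNilpotence (hc : IsFilteredColimit c)
    (hD : ∀ j, (D.obj j).IsLocalTTCat)
    (hexact : ∀ {i j : J} (f : i ⟶ j), IsExactFunctor (D.map f))
    (hlocal : ∀ {i j : J} (f : i ⟶ j), IsLocalFunctor (D.map f))
    (hnil : ∀ j, (D.obj j).ExactNilpotence)
    (hpt : c.pt.IsSymMonStable) (hleg : ∀ j, IsExactFunctor (c.ι.app j)) :
    c.pt.ExactNilpotence := by
  have hqD (j : J) : Quasicategory (D.obj j).underlying := (hD j).stable.quasicategory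
  have hqpt : Quasicategory c.pt.underlying := hpt.stable.quasicategory
  have hzero {j : J} {x : (D.obj j).underlying _⦋0⦌} (hx : IsZeroObj (onSimplex (Y := c.pt) (c.ι.app j) x)) :
      IsZeroObj x :=
    hc.isZeroObj (fun j => (hD j).toIsSymMonStable) hexact hlocal hpt hleg hx
  intro v s hs hsv
  obtain ⟨j, w, e, hew, he⟩ := hc.exists_arrowIso_unit hqD hqpt hsv
  -- The given triangle is not descended: a new one is formed at the stage from the descended map to
  -- the unit.
  obtain ⟨t, ht, rfl⟩ := (hD j).stable.exists_cofiber e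
  have htf : IsFiberSeq t := ((hD j).stable.fiber_iff_cofiber t).2 ht
  obtain ⟨z, hz, h⟩ := hnil j w t htf hew
  refine ⟨onSimplex (Y := c.pt) (c.ι.app j) z, fun h => hz (hzero h), h.imp (fun h => ?_)
    (fun h => ?_)⟩
  · exact (h.map (Y := c.pt) (hleg j)).of_arrowIso hpt.symMon he
  -- Here `k` is isomorphic to `s.second` and kills the image of `t.first`. It therefore factors
  -- through the image of `t.second`, whose product with the image of `z` is nilpotent.
  · obtain ⟨k, m, hk, hm, hks⟩ := hs.exists_null_comp_of_arrowIso he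
    have ht' : IsCofiberSeq (C := c.pt.underlying) (t.map ((c.ι.app j).app (FinPt.mk 1))) :=
      (hpt.stable.fiber_iff_cofiber _).1 ((hleg j).fiber t htf)
    obtain ⟨h', hh'⟩ := ht'.exists_comp (k := k) (m := m)
      (by rw [Square.map_first]; exact hk) hm
    rw [Square.map_second] at hh'
    exact ((h.map (Y := c.pt) (hleg j)).of_comp hpt.symMon hh').of_arrowIso hpt.symMon hks

end GammaSSet

theorem theorem3p14 {J : Type u} [SmallCategory J] [IsFiltered J]
    (D : J ⥤ GammaSSet.{u}) (c : Limits.Cocone D)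
    (hD : ∀ j, (D.obj j).IsLocalTTCat)
    (hexact : ∀ {i j : J} (f : i ⟶ j), GammaSSet.IsExactFunctor (D.map f))
    (hlocal : ∀ {i j : J} (f : i ⟶ j), GammaSSet.IsLocalFunctor (D.map f))
    (hnil : ∀ j, (D.obj j).ExactNilpotence)
    (hpt : c.pt.IsSymMonStable)
    (hleg : ∀ j, GammaSSet.IsExactFunctor (c.ι.app j))
    (hc : GammaSSet.IsFilteredColimit c) :
    c.pt.IsLocalTTCat ∧ c.pt.ExactNilpotence :=
  ⟨hc.isLocalTTCat hD hexact hlocal hpt hleg,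
    hc.exactNilpotence hD hexact hlocal hnil hpt hleg⟩
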